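/- **Setting.** Let $(\mathcal C,\mathcal N)$ be a homological category in the sense of Grandis: $\mathcal N$ is a closed ideal of null morphisms (the morphisms factoring through an object of some class of objects), every morphism has a kernel and a cokernel with respect to $\mathcal N$, kernels and cokernels are closed under composition, and for every kernel $i:A\rightarrowtail B$ and cokernel $q:B\twoheadrightarrow Q$ with $(\operatorname{coker} i)(\ker q)\in\mathcal N$ one has $qi=\iota\pi$ with $\pi$ a cokernel and $\iota$ a kernel. Put $\operatorname{im}f=\ker(\operatorname{coker}f)$, $\operatorname{coim}f=\operatorname{coker}(\ker f)$. A morphism $f=(\operatorname{im} f)\,\bar f\,(\operatorname{coim} f)$ is *exact* if $\bar f$ is an isomorphism; a sequence $\xrightarrow{u}\cdot\xrightarrow{v}$ is *exact* at the middle object if $\operatorname{im}u=\ker v$. The homology of a null sequence $X\xrightarrow{u}Y\xrightarrow{v}Z$ is $H=\operatorname{Coker}(X\to\operatorname{Ker}v)\cong\operatorname{Ker}(\operatorname{Coker}u\to Z)$. For a commutative square $S$ with $bf=ga$ (top $f:A\to B$, left $a:A\to C$, right $b:B\to D$, bottom $g:C\to D$), $\operatorname{Im}S$ is the cokernel of the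 canonical morphism $\lambda_S$ from $A$ to the pullback of $\operatorname{im}b$ and $\operatorname{im}g$, and $\operatorname{Ker}S$ is the kernel of the canonical morphism $\rho_S$ from the pushout of $\operatorname{coim}a$ and $\operatorname{coim}f$ to $D$. Consider a commutative diagram with null rows $A\xrightarrow{f}B\xrightarrow{g}C$ and $A'\xrightarrow{f'}B'\xrightarrow{g'}C'$, vertical morphisms $a,b,c$, left square $S$ and right square $T$. Let $H,H'$ be the homologies of the rows, and $H\to H'$ the induced morphism. Let $\check b:\operatorname{Coker}f\to\operatorname{Coker}f'$ and $\hat b:\operatorname{Ker}g\to\operatorname{Ker}g'$ be induced by $b$, and let $$\xi:\operatorname{Ker}b\to\operatorname{Ker}\check b,\quad \eta:\operatorname{Ker}\check b\to\operatorname{Ker}c,\quad \eta':\operatorname{Coker}a\to\operatorname{Coker}\hat b,\quad \xi':\operatorname{Coker}\hat b\to\operatorname{Coker}b$$ be the morphisms induced by $\operatorname{coker}f$, $\operatorname{Coker}f\to C$, $A'\to\operatorname{Ker}g'$ and $\ker g'$ respectively. Suppose that $b$, $f$ and $g'$ are exact. Consider the second Nomura sequence $$\operatorname{Ker}S\xrightarrow{p_1}H(\operatorname{Ker}a\to\operatorname{Ker}b\to\operatorname{Ker}c)\xrightarrow{\varkappa}\operatorname{Ker}(H\to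 H')\xrightarrow{\beta}\operatorname{Im}S\xrightarrow{\Lambda}\operatorname{Ker}T\xrightarrow{\beta'}\operatorname{Coker}(H\to H')\xrightarrow{\varkappa'}H(\operatorname{Coker}a\to\operatorname{Coker}b\to\operatorname{Coker}c)\xrightarrow{p_1'}\operatorname{Im}T,$$ whose morphisms are as follows. * $\Lambda$ is Lambek's morphism: with $l$ the projection from the pullback defining $\operatorname{Im}S$ to $\operatorname{Im}b$ and $r$ the morphism from $\operatorname{Coim}b\cong\operatorname{Im}b$ to the pushout defining $\operatorname{Ker}T$, it is the unique morphism with $rl=(\ker\rho_T)\,\Lambda\,(\operatorname{coker}\lambda_S)$. Lambek's morphism is defined in the same way for any two adjacent squares with null rows (or columns) and exact middle morphism, and it is an isomorphism if these are exact. * $\beta$ is $(\operatorname{coker}\xi)(\ker\eta):\operatorname{Ker}\eta\to\operatorname{Coker}\xi$, where $\operatorname{Ker}(H\to H')\cong\operatorname{Ker}\eta$ canonically and $\operatorname{Coker}\xi=\operatorname{Im}S_2\cong\operatorname{Ker}S_1\cong\operatorname{Im}S$ by Lambek's isomorphisms for the square $S_1$ formed by $\operatorname{coker}f,b,\check b,\operatorname{coker}f'$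 and the square $S_2$ formed by $\xi,\ker b,\ker\check b,\operatorname{coker}f$. * $\varkappa$ is induced by the morphism $\operatorname{Ker}(\eta\xi)\to\operatorname{Ker}\eta\cong\operatorname{Ker}(H\to H')$ given by $\xi$, where $\eta\xi$ is the morphism $\operatorname{Ker}b\to\operatorname{Ker}c$. * $p_1$ is induced by $\operatorname{Ker}\xi\to\operatorname{Ker}(\eta\xi)$, where $\operatorname{Coker}(\operatorname{Ker}a\to\operatorname{Ker}\xi)=\operatorname{Im}S_0\cong\operatorname{Ker}S$ by Lambek's isomorphism for the square $S_0$ formed by $\operatorname{Ker}a\to\operatorname{Ker}b$, $\ker a$, $\ker b$, $f$. * $\beta',\varkappa',p_1'$ are defined dually. **Theorem.** The second Nomura sequence is a null sequence, and: (i) $p_1=\ker\varkappa$ and $p_1'=\operatorname{coker}\varkappa'$. If $(\operatorname{coker}f)(\ker b)$ is exact, then the sequence is exact at $\operatorname{Ker}(H\to H')$ and $\varkappa$ is an exact morphism. If $(\operatorname{coker}b)(\ker g')$ is exact, then the sequence is exact at $\operatorname{Coker}(H\to H')$ and $\varkappa'$ is an exact morphism. (ii) If $g$ and $\eta$ are exact,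 then the sequence is exact at $\operatorname{Im}S$ and $\Lambda$ is an exact morphism. If $f'$ and $\eta'$ are exact, then the sequence is exact at $\operatorname{Ker}T$ and $\Lambda$ is an exact morphism. -/

import Mathlib

open CategoryTheory CategoryTheory.Limits

namespace Nomura

universe v u

/-- A category with null morphisms: a category with a distinguished ideal of morphisms. -/
class NullCategory (𝒞 : Type u) [Category.{v} 𝒞] where
  /-- the ideal of null morphisms -/
  null : MorphismProperty 𝒞
  null_comp : ∀ {W X Y Z : 𝒞} (h : W ⟶ X) (f : X ⟶ Y) (g : Y ⟶ Z), null f → null (h ≫ f ≫ g)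

section Basic

variable {𝒞 : Type u} [Category.{v} 𝒞] [NullCategory 𝒞]

/-- `f` is a null morphism. -/
abbrev Null {X Y : 𝒞} (f : X ⟶ Y) : Prop := NullCategory.null (𝒞 := 𝒞) f

/-- `k` is a kernel of `f` with respect to the ideal of null morphisms. -/
structure IsKernel {X Y K : 𝒞} (f : X ⟶ Y) (k : K ⟶ X) : Prop where
  null : Null (k ≫ f)
  lift : ∀ {W : 𝒞} (x : W ⟶ X), Null (x ≫ f) → ∃! x' : W ⟶ K, x' ≫ k = x

/-- `l` is a cokernel of `f` with respect to the ideal of null morphisms. -/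
structure IsCokernel {X Y L : 𝒞} (f : X ⟶ Y) (l : Y ⟶ L) : Prop where
  null : Null (f ≫ l)
  desc : ∀ {W : 𝒞} (y : Y ⟶ W), Null (f ≫ y) → ∃! y' : L ⟶ W, l ≫ y' = y

/-- `k` is a kernel of some morphism. -/
def IsSomeKernel {K X : 𝒞} (k : K ⟶ X) : Prop := ∃ (Y : 𝒞) (f : X ⟶ Y), IsKernel f k

/-- `l` is a cokernel of some morphism. -/
def IsSomeCokernel {Y L : 𝒞} (l : Y ⟶ L) : Prop := ∃ (X : 𝒞) (f : X ⟶ Y), IsCokernel f l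

end Basic

/-- A semiexact category: the ideal of null morphisms is closed (it consists of the morphisms that
factor through an object of some class of objects), and all kernels and cokernels exist. -/
class SemiexactCategory (𝒞 : Type u) [Category.{v} 𝒞] extends NullCategory 𝒞 where
  closed : ∃ O : ObjectProperty 𝒞, ∀ {X Y : 𝒞} (f : X ⟶ Y),
    Null f ↔ ∃ (Z : 𝒞) (_ : O Z) (s : X ⟶ Z) (t : Z ⟶ Y), s ≫ t = f
  exists_ker : ∀ {X Y : 𝒞} (f : X ⟶ Y), ∃ (K : 𝒞) (k : K ⟶ X), IsKernel f k
  exists_coker : ∀ {X Y : 𝒞} (f : X ⟶ Y), ∃ (L : 𝒞) (l : Y ⟶ L), IsCokernel f l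

/-- A homological category in the sense of Grandis: a semiexact category in which kernels and
cokernels are closed under composition, and in which the homology axiom holds. -/
class HomologicalCategory (𝒞 : Type u) [Category.{v} 𝒞] extends SemiexactCategory 𝒞 where
  ker_comp : ∀ {X Y Z : 𝒞} (k : X ⟶ Y) (l : Y ⟶ Z),
    IsSomeKernel k → IsSomeKernel l → IsSomeKernel (k ≫ l)
  coker_comp : ∀ {X Y Z : 𝒞} (k : X ⟶ Y) (l : Y ⟶ Z),
    IsSomeCokernel k → IsSomeCokernel l → IsSomeCokernel (k ≫ l)
  homology : ∀ {A B Q : 𝒞} (i : A ⟶ B) (q : B ⟶ Q), IsSomeKernel i → IsSomeCokernel q →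
    (∀ {K L : 𝒞} (k : K ⟶ B) (l : B ⟶ L), IsKernel q k → IsCokernel i l → Null (k ≫ l)) →
    ∃ (H : 𝒞) (π : A ⟶ H) (ι : H ⟶ Q), IsSomeCokernel π ∧ IsSomeKernel ι ∧ π ≫ ι = i ≫ q

noncomputable section

variable {𝒞 : Type u} [Category.{v} 𝒞]

section NullLemmas

variable [NullCategory 𝒞] {W X Y Z : 𝒞}

lemma null_left (h : W ⟶ X) {f : X ⟶ Y} (hf : Null f) : Null (h ≫ f) := by
  simpa using NullCategory.null_comp h f (𝟙 Y) hf

lemma null_right {f : X ⟶ Y} (hf : Null f) (g : Y ⟶ Z) : Null (f ≫ g) := by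
  simpa using NullCategory.null_comp (𝟙 X) f g hf

lemma IsKernel.mono {f : X ⟶ Y} {k : W ⟶ X} (h : IsKernel f k) : Mono k :=
  ⟨fun {V} x y e => (h.lift (x ≫ k) (by
    rw [Category.assoc]; exact null_left x h.null)).unique rfl e.symm⟩

lemma IsCokernel.epi {f : X ⟶ Y} {l : Y ⟶ Z} (h : IsCokernel f l) : Epi l :=
  ⟨fun {V} x y e => (h.desc (l ≫ x) (by
    rw [← Category.assoc]; exact null_right h.null x)).unique rfl e.symm⟩

end NullLemmas

section Semiexact

variable [SemiexactCategory 𝒞] {V W X Y Z : 𝒞}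

/-- A kernel is an `N`-monomorphism. -/
lemma IsKernel.null_of {f : X ⟶ Y} {k : W ⟶ X} (h : IsKernel f k) {x : V ⟶ W}
    (hx : Null (x ≫ k)) : Null x := by
  obtain ⟨O, hO⟩ := SemiexactCategory.closed (𝒞 := 𝒞)
  obtain ⟨Z, hZ, s, t, e⟩ := (hO _).1 hx
  have hid : Null (𝟙 Z) := (hO _).2 ⟨Z, hZ, 𝟙 Z, 𝟙 Z, by simp⟩
  have ht : Null t := by simpa using null_right hid t
  obtain ⟨t', ht', -⟩ := h.lift t (null_right ht f)
  have := h.mono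
  have : s ≫ t' = x := by
    rw [← cancel_mono k, Category.assoc, ht', e]
  exact (hO x).2 ⟨Z, hZ, s, t', this⟩

/-- A cokernel is an `N`-epimorphism. -/
lemma IsCokernel.null_of {f : X ⟶ Y} {l : Y ⟶ Z} (h : IsCokernel f l) {x : Z ⟶ V}
    (hx : Null (l ≫ x)) : Null x := by
  obtain ⟨O, hO⟩ := SemiexactCategory.closed (𝒞 := 𝒞)
  obtain ⟨Z, hZ, s, t, e⟩ := (hO _).1 hx
  have hid : Null (𝟙 Z) := (hO _).2 ⟨Z, hZ, 𝟙 Z, 𝟙 Z, by simp⟩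
  have hs : Null s := by simpa using null_left s hid
  obtain ⟨s', hs', -⟩ := h.desc s (null_left f hs)
  have := h.epi
  have : s' ≫ t = x := by
    rw [← cancel_epi l, ← Category.assoc, hs', e]
  exact (hO x).2 ⟨Z, hZ, s', t, this⟩

/-! Chosen kernels and cokernels. -/

/-- the kernel object -/
def Ker (f : X ⟶ Y) : 𝒞 := (SemiexactCategory.exists_ker f).choose

/-- the kernel morphism -/
def ker (f : X ⟶ Y) : Ker f ⟶ X := (SemiexactCategory.exists_ker f).choose_spec.choose

lemma ker_isKernel (f : X ⟶ Y) : IsKernel f (ker f) :=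
  (SemiexactCategory.exists_ker f).choose_spec.choose_spec

/-- the cokernel object -/
def Coker (f : X ⟶ Y) : 𝒞 := (SemiexactCategory.exists_coker f).choose

/-- the cokernel morphism -/
def coker (f : X ⟶ Y) : Y ⟶ Coker f := (SemiexactCategory.exists_coker f).choose_spec.choose

lemma coker_isCokernel (f : X ⟶ Y) : IsCokernel f (coker f) :=
  (SemiexactCategory.exists_coker f).choose_spec.choose_spec

instance (f : X ⟶ Y) : Mono (ker f) := (ker_isKernel f).mono

instance (f : X ⟶ Y) : Epi (coker f) := (coker_isCokernel f).epi

lemma ker_null (f : X ⟶ Y) : Null (ker f ≫ f) := (ker_isKernel f).null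

lemma coker_null (f : X ⟶ Y) : Null (f ≫ coker f) := (coker_isCokernel f).null

/-- the factorization of `x` through the kernel of `f` -/
def kerLift (f : X ⟶ Y) (x : W ⟶ X) (hx : Null (x ≫ f)) : W ⟶ Ker f :=
  ((ker_isKernel f).lift x hx).choose

@[simp]
lemma kerLift_ker (f : X ⟶ Y) (x : W ⟶ X) (hx : Null (x ≫ f)) : kerLift f x hx ≫ ker f = x :=
  ((ker_isKernel f).lift x hx).choose_spec.1

@[simp]
lemma kerLift_ker_assoc (f : X ⟶ Y) (x : W ⟶ X) (hx : Null (x ≫ f)) (g : X ⟶ Z) :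
    kerLift f x hx ≫ ker f ≫ g = x ≫ g := by
  rw [← Category.assoc, kerLift_ker]

/-- the factorization of `y` through the cokernel of `f` -/
def cokerDesc (f : X ⟶ Y) (y : Y ⟶ W) (hy : Null (f ≫ y)) : Coker f ⟶ W :=
  ((coker_isCokernel f).desc y hy).choose

@[simp]
lemma coker_cokerDesc (f : X ⟶ Y) (y : Y ⟶ W) (hy : Null (f ≫ y)) :
    coker f ≫ cokerDesc f y hy = y :=
  ((coker_isCokernel f).desc y hy).choose_spec.1

@[simp]
lemma coker_cokerDesc_assoc (f : X ⟶ Y) (y : Y ⟶ W) (hy : Null (f ≫ y)) (g : W ⟶ Z) :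
    coker f ≫ cokerDesc f y hy ≫ g = y ≫ g := by
  rw [← Category.assoc, coker_cokerDesc]

/-! Images, coimages, the normal decomposition, exactness. -/

/-- the image object -/
abbrev Im (f : X ⟶ Y) : 𝒞 := Ker (coker f)

/-- the image morphism -/
abbrev im (f : X ⟶ Y) : Im f ⟶ Y := ker (coker f)

/-- the coimage object -/
abbrev Coim (f : X ⟶ Y) : 𝒞 := Coker (ker f)

/-- the coimage morphism -/
abbrev coim (f : X ⟶ Y) : X ⟶ Coim f := coker (ker f)

/-- the corestriction of `f` to its image -/
def toIm (f : X ⟶ Y) : X ⟶ Im f := kerLift (coker f) f (coker_null f)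

@[simp]
lemma toIm_im (f : X ⟶ Y) : toIm f ≫ im f = f := kerLift_ker _ _ _

@[simp]
lemma toIm_im_assoc (f : X ⟶ Y) (g : Y ⟶ Z) : toIm f ≫ im f ≫ g = f ≫ g := by
  rw [← Category.assoc, toIm_im]

/-- the middle morphism of the normal decomposition `f = coim f ≫ mid f ≫ im f` -/
def mid (f : X ⟶ Y) : Coim f ⟶ Im f :=
  cokerDesc (ker f) (toIm f) ((ker_isKernel (coker f)).null_of (by
    rw [Category.assoc, toIm_im]; exact ker_null f))

@[simp]
lemma coim_mid (f : X ⟶ Y) : coim f ≫ mid f = toIm f := coker_cokerDesc _ _ _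

@[simp]
lemma coim_mid_assoc (f : X ⟶ Y) (g : Im f ⟶ Z) : coim f ≫ mid f ≫ g = toIm f ≫ g := by
  rw [← Category.assoc, coim_mid]

/-- the induced morphism from the coimage of `f` to the target of `f` -/
abbrev fromCoim (f : X ⟶ Y) : Coim f ⟶ Y := mid f ≫ im f

lemma coim_fromCoim (f : X ⟶ Y) : coim f ≫ fromCoim f = f := by simp

/-- `f` is an exact morphism. -/
def IsExact (f : X ⟶ Y) : Prop := IsIso (mid f)

/-- The sequence `f, g` is exact at its middle object: `im f = ker g`. -/
def ExactAt (f : X ⟶ Y) (g : Y ⟶ Z) : Prop := IsKernel g (im f)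

lemma im_null {f : X ⟶ Y} {g : Y ⟶ Z} (w : Null (f ≫ g)) : Null (im f ≫ g) := by
  have := null_right (ker_null (coker f)) (cokerDesc f g w)
  simpa using this

lemma null_coim {f : X ⟶ Y} {g : Y ⟶ Z} (w : Null (f ≫ g)) : Null (f ≫ coim g) := by
  have := null_left (kerLift g f w) (coker_null (ker g))
  simpa using this

lemma null_coker_coker (f : X ⟶ Y) : Null (coker (coker f)) :=
  (coker_isCokernel f).null_of (coker_null _)

lemma null_ker_ker (f : X ⟶ Y) : Null (ker (ker f)) :=
  (ker_isKernel f).null_of (ker_null _)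

/-! Morphisms induced on kernels and cokernels by a commutative square

```
  X --f--> Y
  |a       |b
  V --g--> W
``` -/

section Induced

variable {f : X ⟶ Y} {a : X ⟶ V} {b : Y ⟶ W} {g : V ⟶ W}

/-- the morphism `Ker a ⟶ Ker b` induced by `f` -/
def kerMap (S : CommSq f a b g) : Ker a ⟶ Ker b :=
  kerLift b (ker a ≫ f) (by
    rw [Category.assoc, S.w, ← Category.assoc]; exact null_right (ker_null a) g)

@[simp]
lemma kerMap_ker (S : CommSq f a b g) : kerMap S ≫ ker b = ker a ≫ f := kerLift_ker _ _ _

@[simp]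
lemma kerMap_ker_assoc (S : CommSq f a b g) (t : Y ⟶ Z) :
    kerMap S ≫ ker b ≫ t = ker a ≫ f ≫ t := by
  rw [← Category.assoc, kerMap_ker, Category.assoc]

/-- the morphism `Coker a ⟶ Coker b` induced by `g` -/
def cokerMap (S : CommSq f a b g) : Coker a ⟶ Coker b :=
  cokerDesc a (g ≫ coker b) (by
    rw [← Category.assoc, ← S.w, Category.assoc]; exact null_left f (coker_null b))

@[simp]
lemma coker_cokerMap (S : CommSq f a b g) : coker a ≫ cokerMap S = g ≫ coker b :=
  coker_cokerDesc _ _ _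

@[simp]
lemma coker_cokerMap_assoc (S : CommSq f a b g) (t : Coker b ⟶ Z) :
    coker a ≫ cokerMap S ≫ t = g ≫ coker b ≫ t := by
  rw [← Category.assoc, coker_cokerMap, Category.assoc]

end Induced

/-! Pullbacks of kernels and pushouts of cokernels exist. -/

lemma isPullback_ker {K : 𝒞} (f : X ⟶ Z) (q : Z ⟶ W) (k : K ⟶ Z) (hk : IsKernel q k) :
    ∃ t : Ker (f ≫ q) ⟶ K, IsPullback (ker (f ≫ q)) t f k := by
  have hn : Null ((ker (f ≫ q) ≫ f) ≫ q) := by rw [Category.assoc]; exact ker_null _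
  obtain ⟨t, ht, -⟩ := hk.lift _ hn
  have := hk.mono
  refine ⟨t, ⟨⟨ht.symm⟩, ⟨PullbackCone.IsLimit.mk _
    (fun s => kerLift (f ≫ q) s.fst ?_) ?_ ?_ ?_⟩⟩⟩
  · rw [← Category.assoc, s.condition, Category.assoc]
    exact null_left _ hk.null
  · intro s; simp
  · intro s
    rw [← cancel_mono k, Category.assoc, ht, kerLift_ker_assoc, s.condition]
  · intro s m h1 _
    rw [← cancel_mono (ker (f ≫ q)), h1, kerLift_ker]

lemma isPushout_coker {L : 𝒞} (f : Z ⟶ X) (q : W ⟶ Z) (l : Z ⟶ L) (hl : IsCokernel q l) :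
    ∃ t : L ⟶ Coker (q ≫ f), IsPushout f l (coker (q ≫ f)) t := by
  have hn : Null (q ≫ f ≫ coker (q ≫ f)) := by rw [← Category.assoc]; exact coker_null _
  obtain ⟨t, ht, -⟩ := hl.desc _ hn
  have := hl.epi
  refine ⟨t, ⟨⟨ht.symm⟩, ⟨PushoutCocone.IsColimit.mk _
    (fun s => cokerDesc (q ≫ f) s.inl ?_) ?_ ?_ ?_⟩⟩⟩
  · rw [Category.assoc, s.condition, ← Category.assoc]
    exact null_right hl.null _
  · intro s; simp
  · intro s
    rw [← cancel_epi l, ← Category.assoc, ht, Category.assoc, coker_cokerDesc, s.condition]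
  · intro s m h1 _
    rw [← cancel_epi (coker (q ≫ f)), h1, coker_cokerDesc]

instance (b : X ⟶ Z) (g : Y ⟶ Z) : HasPullback (im b) (im g) :=
  (isPullback_ker (im b) (coker g) (im g) (ker_isKernel _)).choose_spec.hasPullback

instance (a : X ⟶ Y) (f : X ⟶ Z) : HasPushout (coim a) (coim f) :=
  (isPushout_coker (coim a) (ker f) (coim f) (coker_isCokernel _)).choose_spec.hasPushout

/-! Lambek's invariants of a commutative square

```
  X --f--> Y
  |a       |b
  V --g--> W
``` -/

section Square

variable {f : X ⟶ Y} {a : X ⟶ V} {b : Y ⟶ W} {g : V ⟶ W}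

/-- the morphism from `X` to the pullback of `im b` and `im g` -/
def sqLam (S : CommSq f a b g) : X ⟶ pullback (im b) (im g) :=
  pullback.lift (f ≫ toIm b) (a ≫ toIm g) (by simp [S.w])

/-- the morphism from the pushout of `coim a` and `coim f` to `W` -/
def sqRho (S : CommSq f a b g) : pushout (coim a) (coim f) ⟶ W :=
  pushout.desc (fromCoim a ≫ g) (fromCoim f ≫ b) (by simp [S.w])

@[simp]
lemma sqLam_fst (S : CommSq f a b g) : sqLam S ≫ pullback.fst (im b) (im g) = f ≫ toIm b :=
  pullback.lift_fst _ _ _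

@[simp]
lemma sqLam_snd (S : CommSq f a b g) : sqLam S ≫ pullback.snd (im b) (im g) = a ≫ toIm g :=
  pullback.lift_snd _ _ _

@[simp]
lemma inl_sqRho (S : CommSq f a b g) :
    pushout.inl (coim a) (coim f) ≫ sqRho S = fromCoim a ≫ g :=
  pushout.inl_desc _ _ _

@[simp]
lemma inr_sqRho (S : CommSq f a b g) :
    pushout.inr (coim a) (coim f) ≫ sqRho S = fromCoim f ≫ b :=
  pushout.inr_desc _ _ _

/-- the invariant `Im S` of a commutative square `S` -/
abbrev SqIm (S : CommSq f a b g) : 𝒞 := Coker (sqLam S)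

/-- the invariant `Ker S` of a commutative square `S` -/
abbrev SqKer (S : CommSq f a b g) : 𝒞 := Ker (sqRho S)

/-- the canonical identification of `Im S` with `Im` of the transposed square -/
def sqImFlip (S : CommSq f a b g) : SqIm S ⟶ SqIm S.flip :=
  cokerDesc _ (pullback.lift (pullback.snd _ _) (pullback.fst _ _) pullback.condition.symm ≫
    coker (sqLam S.flip)) (by
    have : sqLam S ≫ pullback.lift (pullback.snd _ _) (pullback.fst _ _)
        pullback.condition.symm = sqLam S.flip := by
      apply pullback.hom_ext
      · rw [Category.assoc, pullback.lift_fst, sqLam_snd, sqLam_fst]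
      · rw [Category.assoc, pullback.lift_snd, sqLam_snd, sqLam_fst]
    rw [← Category.assoc, this]
    exact coker_null _)

/-- the canonical identification of `Ker S` with `Ker` of the transposed square -/
def sqKerFlip (S : CommSq f a b g) : SqKer S ⟶ SqKer S.flip :=
  kerLift _ (ker (sqRho S) ≫ pushout.desc (pushout.inr _ _) (pushout.inl _ _)
    pushout.condition.symm) (by
    have : pushout.desc (pushout.inr _ _) (pushout.inl _ _) pushout.condition.symm ≫
        sqRho S.flip = sqRho S := by
      apply pushout.hom_ext
      · rw [← Category.assoc, pushout.inl_desc, inl_sqRho, inr_sqRho]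
      · rw [← Category.assoc, pushout.inr_desc, inl_sqRho, inr_sqRho]
    rw [Category.assoc, this]
    exact ker_null _)

end Square

/-! Lambek's morphism of two consecutive squares

```
  A --f--> B --g--> C
  |a   S   |b   T   |c
  A'--f'-> B'--g'-> C'
``` -/

section Lambek

variable {A B C A' B' C' : 𝒞} {f : A ⟶ B} {g : B ⟶ C} {f' : A' ⟶ B'} {g' : B' ⟶ C'}
  {a : A ⟶ A'} {b : B ⟶ B'} {c : C ⟶ C'}

/-- the inverse of the middle isomorphism of an exact morphism -/
def midInv (b : B ⟶ B') (hb : IsExact b) : Im b ⟶ Coim b :=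
  @inv _ _ _ _ (mid b) hb

@[simp]
lemma mid_midInv (b : B ⟶ B') (hb : IsExact b) : mid b ≫ midInv b hb = 𝟙 _ :=
  @IsIso.hom_inv_id _ _ _ _ (mid b) hb

@[simp]
lemma midInv_mid (b : B ⟶ B') (hb : IsExact b) : midInv b hb ≫ mid b = 𝟙 _ :=
  @IsIso.inv_hom_id _ _ _ _ (mid b) hb

@[simp]
lemma midInv_mid_assoc (b : B ⟶ B') (hb : IsExact b) (t : Im b ⟶ Z) :
    midInv b hb ≫ mid b ≫ t = t := by
  rw [← Category.assoc, midInv_mid, Category.id_comp]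

@[simp]
lemma toIm_midInv (b : B ⟶ B') (hb : IsExact b) : toIm b ≫ midInv b hb = coim b := by
  rw [← coim_mid, Category.assoc, mid_midInv, Category.comp_id]

@[simp]
lemma toIm_midInv_assoc (b : B ⟶ B') (hb : IsExact b) (t : Coim b ⟶ Z) :
    toIm b ≫ midInv b hb ≫ t = coim b ≫ t := by
  rw [← Category.assoc, toIm_midInv]

/-- the composite of `l : M ⟶ Im b`, of the identification of `Im b` with `Coim b`, and of
`r : Coim b ⟶ N`, where `M` is the pullback that defines `Im S` and `N` is the pushout that
defines `Ker T` -/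
def lambekAux (b : B ⟶ B') (hb : IsExact b) (f' : A' ⟶ B') (g : B ⟶ C) :
    pullback (im b) (im f') ⟶ pushout (coim b) (coim g) :=
  pullback.fst (im b) (im f') ≫ midInv b hb ≫ pushout.inl (coim b) (coim g)

lemma lambekAux_null_left (S : CommSq f a b f') (hb : IsExact b) (hfg : Null (f ≫ g)) :
    Null (sqLam S ≫ lambekAux b hb f' g) := by
  have := null_right (null_coim hfg) (pushout.inr (coim b) (coim g))
  rw [Category.assoc, ← pushout.condition] at this
  rw [lambekAux, ← Category.assoc, sqLam_fst]
  simpa using this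

lemma lambekAux_null_right (T : CommSq g b c g') (hb : IsExact b) (hfg' : Null (f' ≫ g')) :
    Null (lambekAux b hb f' g ≫ sqRho T) := by
  have := null_left (pullback.snd (im b) (im f')) (im_null hfg')
  rw [← Category.assoc, ← pullback.condition] at this
  simpa [lambekAux] using this

/-- Lambek's morphism `Im S ⟶ Ker T` -/
def lambek (S : CommSq f a b f') (T : CommSq g b c g') (hb : IsExact b)
    (hfg : Null (f ≫ g)) (hfg' : Null (f' ≫ g')) : SqIm S ⟶ SqKer T :=
  kerLift _ (cokerDesc _ (lambekAux b hb f' g) (lambekAux_null_left S hb hfg))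
    ((coker_isCokernel (sqLam S)).null_of (by
      rw [coker_cokerDesc_assoc]; exact lambekAux_null_right T hb hfg'))

@[simp]
lemma coker_lambek_ker (S : CommSq f a b f') (T : CommSq g b c g') (hb : IsExact b)
    (hfg : Null (f ≫ g)) (hfg' : Null (f' ≫ g')) :
    coker (sqLam S) ≫ lambek S T hb hfg hfg' ≫ ker (sqRho T) = lambekAux b hb f' g := by
  simp [lambek]

end Lambek

/-! Homology of a null sequence. -/

section Homology

variable (f : X ⟶ Y) (g : Y ⟶ Z) (w : Null (f ≫ g))

/-- the (left) homology of the null sequence `f, g` -/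
abbrev Homology : 𝒞 := Coker (kerLift g f w)

/-- the right homology of the null sequence `f, g` -/
abbrev RHomology : 𝒞 := Ker (cokerDesc f g w)

/-- the canonical morphism from the left homology to the right homology -/
def homologyComparison : Homology f g w ⟶ RHomology f g w :=
  kerLift _ (cokerDesc (kerLift g f w) (ker g ≫ coker f) (by
    rw [kerLift_ker_assoc]; exact coker_null f)) ((coker_isCokernel (kerLift g f w)).null_of (by
      rw [coker_cokerDesc_assoc, Category.assoc, coker_cokerDesc]; exact ker_null g))

@[simp]
lemma coker_homologyComparison_ker : coker (kerLift g f w) ≫ homologyComparison f g w ≫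
    ker (cokerDesc f g w) = ker g ≫ coker f := by
  simp [homologyComparison]

end Homology

end Semiexact

section Homological

variable [HomologicalCategory 𝒞] {V W X Y Z : 𝒞}

/-- The corestriction of a morphism to a kernel through which its image factors is an
`N`-epimorphism. -/
lemma null_of_toIm {I : 𝒞} {f : X ⟶ Y} {q : Y ⟶ Z} {i : I ⟶ Y} (hq : IsCokernel f q)
    (hi : IsKernel q i) {e : X ⟶ I} (he : e ≫ i = f) {y : I ⟶ W} (hy : Null (e ≫ y)) :
    Null y := by
  have := hi.mono
  obtain ⟨Q, r, hr⟩ := HomologicalCategory.ker_comp (ker y) i ⟨_, _, ker_isKernel y⟩ ⟨_, _, hi⟩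
  have hfr : Null (f ≫ r) := by
    have := null_left (kerLift y e hy) hr.null
    rwa [Category.assoc, kerLift_ker_assoc, ← Category.assoc, he] at this
  obtain ⟨d, hd, -⟩ := hq.desc r hfr
  have hir : Null (i ≫ r) := by
    rw [← hd, ← Category.assoc]; exact null_right hi.null d
  obtain ⟨s, hs, -⟩ := hr.lift i hir
  have hs' : s ≫ ker y = 𝟙 _ := by
    rw [← cancel_mono i, Category.assoc, hs, Category.id_comp]
  have := null_left s (ker_null y)
  rwa [← Category.assoc, hs', Category.id_comp] at this

lemma null_of_fromCoim {I : 𝒞} {f : X ⟶ Y} {k : W ⟶ X} {p : X ⟶ I} (hk : IsKernel f k)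
    (hp : IsCokernel k p) {e : I ⟶ Y} (he : p ≫ e = f) {y : Z ⟶ I} (hy : Null (y ≫ e)) :
    Null y := by
  have := hp.epi
  obtain ⟨Q, r, hr⟩ := HomologicalCategory.coker_comp p (coker y) ⟨_, _, hp⟩
    ⟨_, _, coker_isCokernel y⟩
  have hfr : Null (r ≫ f) := by
    have := null_right hr.null (cokerDesc y e hy)
    rwa [Category.assoc, Category.assoc, coker_cokerDesc, he] at this
  obtain ⟨d, hd, -⟩ := hk.lift r hfr
  have hir : Null (r ≫ p) := by
    rw [← hd, Category.assoc]; exact null_left d hp.null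
  obtain ⟨s, hs, -⟩ := hr.desc p hir
  have hs' : coker y ≫ s = 𝟙 _ := by
    rw [← cancel_epi p, ← Category.assoc, hs, Category.comp_id]
  have := null_right (coker_null y) s
  rwa [Category.assoc, hs', Category.comp_id] at this

/-- a kernel is a kernel of any cokernel of it -/
lemma IsKernel.of_cokernel {L : 𝒞} {f : X ⟶ Y} {k : W ⟶ X} {l : X ⟶ L} (h : IsKernel f k)
    (hl : IsCokernel k l) : IsKernel l k :=
  ⟨hl.null, fun x hx => h.lift x (by
    obtain ⟨t, ht, -⟩ := hl.desc f h.null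
    rw [← ht, ← Category.assoc]; exact null_right hx t)⟩

lemma IsCokernel.of_kernel {K : 𝒞} {f : X ⟶ Y} {l : Y ⟶ W} {k : K ⟶ Y} (h : IsCokernel f l)
    (hk : IsKernel l k) : IsCokernel k l :=
  ⟨hk.null, fun y hy => h.desc y (by
    obtain ⟨t, ht, -⟩ := hk.lift f h.null
    rw [← ht, Category.assoc]; exact null_left t hy)⟩

/-- The left and the right homology of a null sequence are isomorphic. -/
lemma isIso_comparison {K Q L M : 𝒞} {f : X ⟶ Y} {g : Y ⟶ Z} {k : K ⟶ Y} {q : Y ⟶ Q}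
    {σ : X ⟶ K} {τ : Q ⟶ Z} {l : K ⟶ L} {j : M ⟶ Q} {m : L ⟶ M}
    (hk : IsKernel g k) (hq : IsCokernel f q) (hσ : σ ≫ k = f) (hτ : q ≫ τ = g)
    (hl : IsCokernel σ l) (hj : IsKernel τ j) (hm : l ≫ m ≫ j = k ≫ q) : IsIso m := by
  obtain ⟨H, π, ι, hπ, hι, e⟩ := HomologicalCategory.homology k q ⟨_, _, hk⟩ ⟨_, _, hq⟩ (by
    intro I J i c hi hc
    have : Null (i ≫ g) := by
      rw [← hτ, ← Category.assoc]; exact null_right hi.null τ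
    obtain ⟨x, hx, -⟩ := hk.lift i this
    rw [← hx, Category.assoc]; exact null_left x hc.null)
  have hkm := hk.mono
  have hqe := hq.epi
  obtain ⟨_, u, hu⟩ := hπ
  obtain ⟨_, w, hw⟩ := hι
  -- `π` is a cokernel of `σ`
  have hπσ : IsCokernel σ π := by
    refine ⟨hw.null_of ?_, fun {V} y hy => ?_⟩
    · rw [Category.assoc, e, ← Category.assoc, hσ]; exact hq.null
    · apply (hu.of_kernel (ker_isKernel π)).desc y
      obtain ⟨z, hz, -⟩ := (ker_isKernel q).lift (ker π ≫ k) (by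
        rw [Category.assoc, ← e, ← Category.assoc]; exact null_right (ker_null π) ι)
      have hx : Null (ker q ≫ g) := by
        rw [← hτ, ← Category.assoc]; exact null_right (ker_null q) τ
      obtain ⟨x, hx, -⟩ := hk.lift _ hx
      obtain ⟨f₁, hf₁, -⟩ := (ker_isKernel q).lift f hq.null
      have h1 : z ≫ x = ker π := by rw [← cancel_mono k, Category.assoc, hx, hz]
      have h2 : f₁ ≫ x = σ := by rw [← cancel_mono k, Category.assoc, hx, hf₁, hσ]
      have h3 : Null (x ≫ y) := null_of_toIm hq (ker_isKernel q) hf₁ (by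
        rw [← Category.assoc, h2]; exact hy)
      rw [← h1, Category.assoc]; exact null_left z h3
  have hιτ : IsKernel τ ι := by
    refine ⟨hu.null_of ?_, fun {V} y hy => ?_⟩
    · rw [← Category.assoc, e, Category.assoc, hτ]; exact hk.null
    · apply (hw.of_cokernel (coker_isCokernel ι)).lift y
      obtain ⟨z, hz, -⟩ := (coker_isCokernel k).desc (q ≫ coker ι) (by
        rw [← Category.assoc, ← e, Category.assoc]; exact null_left π (coker_null ι))
      have hx : Null (f ≫ coker k) := by
        rw [← hσ, Category.assoc]; exact null_left σ (coker_null k)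
      obtain ⟨x, hx, -⟩ := hq.desc _ hx
      obtain ⟨g₁, hg₁, -⟩ := (coker_isCokernel k).desc g hk.null
      have h1 : x ≫ z = coker ι := by rw [← cancel_epi q, ← Category.assoc, hx, hz]
      have h2 : x ≫ g₁ = τ := by rw [← cancel_epi q, ← Category.assoc, hx, hg₁, hτ]
      have h3 : Null (y ≫ x) := null_of_fromCoim hk (coker_isCokernel k) hg₁ (by
        rw [Category.assoc, h2]; exact hy)
      rw [← h1, ← Category.assoc]; exact null_right h3 z
  have hle := hl.epi
  have hπe := hπσ.epi
  have hjm := hj.mono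
  have hιm := hιτ.mono
  obtain ⟨s, hs, -⟩ := hl.desc π hπσ.null
  obtain ⟨s', hs', -⟩ := hπσ.desc l hl.null
  obtain ⟨t, ht, -⟩ := hj.lift ι hιτ.null
  obtain ⟨t', ht', -⟩ := hιτ.lift j hj.null
  have hm' : m = s ≫ t := by
    rw [← cancel_epi l, ← cancel_mono j, Category.assoc, hm, ← e]
    simp only [Category.assoc, ht]
    rw [← Category.assoc, hs]
  refine ⟨t' ≫ s', ?_, ?_⟩
  · have h1 : t ≫ t' = 𝟙 _ := by
      rw [← cancel_mono ι, Category.assoc, ht', ht, Category.id_comp]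
    have h2 : s ≫ s' = 𝟙 _ := by
      rw [← cancel_epi l, ← Category.assoc, hs, hs', Category.comp_id]
    rw [hm', Category.assoc, ← Category.assoc t, h1, Category.id_comp, h2]
  · have h1 : t' ≫ t = 𝟙 _ := by
      rw [← cancel_mono j, Category.assoc, ht, ht', Category.id_comp]
    have h2 : s' ≫ s = 𝟙 _ := by
      rw [← cancel_epi π, ← Category.assoc, hs', hs, Category.comp_id]
    rw [hm', Category.assoc, ← Category.assoc s', h2, Category.id_comp, h1]

instance (f : X ⟶ Y) (g : Y ⟶ Z) (w : Null (f ≫ g)) : IsIso (homologyComparison f g w) :=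
  isIso_comparison (ker_isKernel g) (coker_isCokernel f) (kerLift_ker _ _ _)
    (coker_cokerDesc _ _ _) (coker_isCokernel _) (ker_isKernel _)
    (coker_homologyComparison_ker f g w)

/-- Lambek's isomorphism theorem. -/
lemma isIso_lambek {A B C A' B' C' : 𝒞} {f : A ⟶ B} {g : B ⟶ C} {f' : A' ⟶ B'} {g' : B' ⟶ C'}
    {a : A ⟶ A'} {b : B ⟶ B'} {c : C ⟶ C'} (S : CommSq f a b f') (T : CommSq g b c g')
    (hb : IsExact b) (hfg : Null (f ≫ g)) (hfg' : Null (f' ≫ g'))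
    (h : ExactAt f g) (h' : ExactAt f' g') : IsIso (lambek S T hb hfg hfg') := by
  refine isIso_comparison (f := f ≫ toIm b) (g := im b ≫ g')
    (k := pullback.fst (im b) (im f')) (q := midInv b hb ≫ pushout.inl (coim b) (coim g))
    (σ := sqLam S) (τ := sqRho T) ?_ ?_ ?_ ?_ (coker_isCokernel _) (ker_isKernel _) ?_
  · refine ⟨?_, fun x hx => ?_⟩
    · rw [← Category.assoc, pullback.condition, Category.assoc]
      exact null_left _ (im_null hfg')
    · obtain ⟨y, hy, -⟩ := h'.lift (x ≫ im b) (by rwa [Category.assoc])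
      refine ⟨pullback.lift x y hy.symm, pullback.lift_fst _ _ _, fun z hz => ?_⟩
      apply pullback.hom_ext
      · rw [hz, pullback.lift_fst]
      · rw [pullback.lift_snd, ← cancel_mono (im f'), Category.assoc, ← pullback.condition,
          ← Category.assoc, hz, hy]
  · have hco : IsCokernel f (coim g) := by
      refine ⟨null_coim hfg, fun y hy => (coker_isCokernel (ker g)).desc y ?_⟩
      obtain ⟨t, ht, -⟩ := h.lift (ker g) (ker_null g)
      rw [← ht, Category.assoc]
      exact null_left t (im_null hy)
    refine ⟨?_, fun y hy => ?_⟩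
    · rw [Category.assoc, toIm_midInv_assoc, pushout.condition, ← Category.assoc]
      exact null_right hco.null _
    · obtain ⟨t, ht, -⟩ := hco.desc (toIm b ≫ y) (by rwa [← Category.assoc])
      refine ⟨pushout.desc (mid b ≫ y) t (by rw [coim_mid_assoc, ht]), ?_, fun z hz => ?_⟩
      · beta_reduce
        rw [Category.assoc, pushout.inl_desc, midInv_mid_assoc]
      · apply pushout.hom_ext
        · rw [pushout.inl_desc, ← hz]
          simp only [← Category.assoc, mid_midInv, Category.id_comp]
        · rw [pushout.inr_desc, ← cancel_epi (coim g), ← Category.assoc, ← pushout.condition,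
            ht, ← hz]
          simp
  · rw [sqLam_fst]
  · rw [Category.assoc, inl_sqRho, fromCoim, Category.assoc, midInv_mid_assoc]
  · exact coker_lambek_ker S T hb hfg hfg'

/-! Kernels and cokernels are exact morphisms and fit into exact sequences. -/

lemma IsKernel.isIso {K K' : 𝒞} {f : X ⟶ Y} {k : K ⟶ X} {k' : K' ⟶ X} (h : IsKernel f k)
    (h' : IsKernel f k') {t : K ⟶ K'} (ht : t ≫ k' = k) : IsIso t := by
  have := h.mono
  have := h'.mono
  obtain ⟨s, hs, -⟩ := h.lift k' h'.null
  refine ⟨s, ?_, ?_⟩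
  · rw [← cancel_mono k, Category.assoc, hs, ht, Category.id_comp]
  · rw [← cancel_mono k', Category.assoc, ht, hs, Category.id_comp]

lemma IsCokernel.isIso {L L' : 𝒞} {f : X ⟶ Y} {l : Y ⟶ L} {l' : Y ⟶ L'} (h : IsCokernel f l)
    (h' : IsCokernel f l') {t : L ⟶ L'} (ht : l ≫ t = l') : IsIso t := by
  have := h.epi
  have := h'.epi
  obtain ⟨s, hs, -⟩ := h'.desc l h.null
  refine ⟨s, ?_, ?_⟩
  · rw [← cancel_epi l, ← Category.assoc, ht, hs, Category.comp_id]
  · rw [← cancel_epi l', ← Category.assoc, hs, ht, Category.comp_id]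

lemma exactAt_ker (f : X ⟶ Y) : ExactAt (ker f) f := by
  refine ⟨im_null (ker_null f), fun x hx => ?_⟩
  obtain ⟨t, ht, -⟩ := (ker_isKernel f).lift x hx
  exact (ker_isKernel (coker (ker f))).lift x (by
    rw [← ht, Category.assoc]; exact null_left t (coker_null _))

lemma exactAt_coker (f : X ⟶ Y) : ExactAt f (coker f) := ker_isKernel _

instance (f : X ⟶ Y) : IsIso (toIm (ker f)) :=
  ((ker_isKernel f).of_cokernel (coker_isCokernel _)).isIso (ker_isKernel _) (toIm_im _)

instance (f : X ⟶ Y) : IsIso (fromCoim (coker f)) :=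
  (coker_isCokernel (ker (coker f))).isIso
    ((coker_isCokernel f).of_kernel (ker_isKernel _)) (coim_fromCoim _)

lemma isIso_coim {f : X ⟶ Y} (hf : Null (ker f)) : IsIso (coim f) := by
  have h : IsCokernel (ker f) (𝟙 X) :=
    ⟨null_right hf _, fun y _ => ⟨y, Category.id_comp y, fun z hz => by simpa using hz⟩⟩
  exact h.isIso (coker_isCokernel _) (Category.id_comp _)

lemma isIso_im {f : X ⟶ Y} (hf : Null (coker f)) : IsIso (im f) := by
  have h : IsKernel (coker f) (𝟙 Y) :=
    ⟨null_left _ hf, fun y _ => ⟨y, Category.comp_id y, fun z hz => by simpa using hz⟩⟩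
  exact (ker_isKernel _).isIso h (Category.comp_id _)

lemma isExact_ker (f : X ⟶ Y) : IsExact (ker f) := by
  have := isIso_coim (null_ker_ker f)
  have h : IsIso (coim (ker f) ≫ mid (ker f)) := by rw [coim_mid]; infer_instance
  exact IsIso.of_isIso_comp_left (coim (ker f)) (mid (ker f))

lemma isExact_coker (f : X ⟶ Y) : IsExact (coker f) := by
  have := isIso_im (null_coker_coker f)
  have h : IsIso (mid (coker f) ≫ im (coker f)) := inferInstanceAs (IsIso (fromCoim (coker f)))
  exact IsIso.of_isIso_comp_right (mid (coker f)) (im (coker f))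

end Homological

/-- A commutative diagram with null rows

```
  A --f--> B --g--> C
  |a   S   |b   T   |c
  A'--f'-> B'--g'-> C'
``` -/
structure Diagram (𝒞 : Type u) [Category.{v} 𝒞] [NullCategory 𝒞] where
  {A B C A' B' C' : 𝒞}
  f : A ⟶ B
  g : B ⟶ C
  f' : A' ⟶ B'
  g' : B' ⟶ C'
  a : A ⟶ A'
  b : B ⟶ B'
  c : C ⟶ C'
  S : CommSq f a b f'
  T : CommSq g b c g'
  null : Null (f ≫ g)
  null' : Null (f' ≫ g')

namespace Diagram

variable [HomologicalCategory 𝒞] (D : Diagram 𝒞)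

/-! The homologies of the two rows and the morphism between them. -/

/-- the homology of the first row -/
abbrev H : 𝒞 := Homology D.f D.g D.null

/-- the homology of the second row -/
abbrev H' : 𝒞 := Homology D.f' D.g' D.null'

/-- the morphism `A ⟶ Ker g` induced by `f` -/
abbrev σ : D.A ⟶ Ker D.g := kerLift D.g D.f D.null

/-- the morphism `A' ⟶ Ker g'` induced by `f'` -/
abbrev σ' : D.A' ⟶ Ker D.g' := kerLift D.g' D.f' D.null'

/-- the morphism `Coker f ⟶ C` induced by `g` -/
abbrev τ : Coker D.f ⟶ D.C := cokerDesc D.f D.g D.null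

/-- the morphism `Coker f' ⟶ C'` induced by `g'` -/
abbrev τ' : Coker D.f' ⟶ D.C' := cokerDesc D.f' D.g' D.null'

/-- the morphism `Ker g ⟶ Ker g'` induced by `b` -/
abbrev bHat : Ker D.g ⟶ Ker D.g' := kerMap D.T.flip

/-- the morphism `Coker f ⟶ Coker f'` induced by `b` -/
abbrev bCheck : Coker D.f ⟶ Coker D.f' := cokerMap D.S.flip

lemma sqσ : CommSq D.σ D.a D.bHat D.σ' :=
  ⟨by rw [← cancel_mono (ker D.g')]; simp [D.S.w]⟩

lemma sqτ : CommSq D.τ D.bCheck D.c D.τ' :=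
  ⟨by rw [← cancel_epi (coker D.f)]; simp [D.T.w]⟩

/-- the morphism `H ⟶ H'` induced by the vertical morphisms of the diagram -/
abbrev h : D.H ⟶ D.H' := cokerMap D.sqσ.flip

/-! The morphisms `η`, `ξ` and `η'`, `ξ'`. -/

/-- `η : Ker (Coker f ⟶ Coker f') ⟶ Ker c`, induced by `Coker f ⟶ C` -/
abbrev η : Ker D.bCheck ⟶ Ker D.c := kerMap D.sqτ

/-- `η' : Coker a ⟶ Coker (Ker g ⟶ Ker g')`, induced by `A' ⟶ Ker g'` -/
abbrev η' : Coker D.a ⟶ Coker D.bHat := cokerMap D.sqσ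

lemma S₁ : CommSq (coker D.f) D.b D.bCheck (coker D.f') := ⟨coker_cokerMap D.S.flip⟩

lemma T₁ : CommSq (ker D.g) D.bHat D.b (ker D.g') := ⟨(kerMap_ker D.T.flip).symm⟩

/-- `ξ : Ker b ⟶ Ker (Coker f ⟶ Coker f')`, induced by `coker f` -/
abbrev ξ : Ker D.b ⟶ Ker D.bCheck := kerMap D.S₁

/-- `ξ' : Coker (Ker g ⟶ Ker g') ⟶ Coker b`, induced by `ker g'` -/
abbrev ξ' : Coker D.bHat ⟶ Coker D.b := cokerMap D.T₁

lemma S₂ : CommSq D.ξ (ker D.b) (ker D.bCheck) (coker D.f) := ⟨kerMap_ker D.S₁⟩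

lemma T₂ : CommSq (ker D.g') (coker D.bHat) (coker D.b) D.ξ' := ⟨(coker_cokerMap D.T₁).symm⟩

/-! The row of kernels and the row of cokernels. -/

/-- the morphism `Ker a ⟶ Ker b` -/
abbrev fHat : Ker D.a ⟶ Ker D.b := kerMap D.S

/-- the morphism `Ker b ⟶ Ker c` -/
abbrev gHat : Ker D.b ⟶ Ker D.c := kerMap D.T

/-- the morphism `Coker a ⟶ Coker b` -/
abbrev fCheck : Coker D.a ⟶ Coker D.b := cokerMap D.S

/-- the morphism `Coker b ⟶ Coker c` -/
abbrev gCheck : Coker D.b ⟶ Coker D.c := cokerMap D.T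

lemma ξ_η : D.ξ ≫ D.η = D.gHat := by
  rw [← cancel_mono (ker D.c)]; simp

lemma η'_ξ' : D.η' ≫ D.ξ' = D.fCheck := by
  rw [← cancel_epi (coker D.a)]; simp

lemma fHat_ξ : Null (D.fHat ≫ D.ξ) := by
  apply (ker_isKernel D.bCheck).null_of
  have := null_left (ker D.a) (coker_null D.f)
  simpa using this

lemma ξ'_gCheck : Null (D.ξ' ≫ D.gCheck) := by
  apply (coker_isCokernel D.bHat).null_of
  have := null_right (ker_null D.g') (coker D.c)
  simpa using this

lemma fHat_gHat : Null (D.fHat ≫ D.gHat) := by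
  rw [← ξ_η, ← Category.assoc]; exact null_right D.fHat_ξ _

lemma fCheck_gCheck : Null (D.fCheck ≫ D.gCheck) := by
  rw [← η'_ξ', Category.assoc]; exact null_left _ D.ξ'_gCheck

/-- the homology of `Ker a ⟶ Ker b ⟶ Ker c` -/
abbrev HKer : 𝒞 := Homology D.fHat D.gHat D.fHat_gHat

/-- the homology of `Coker a ⟶ Coker b ⟶ Coker c` -/
abbrev HCoker : 𝒞 := Homology D.fCheck D.gCheck D.fCheck_gCheck

/-! The identifications `Ker (H ⟶ H') ≅ Ker η` and `Coker (H ⟶ H') ≅ Coker η'`. -/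

/-- the embedding of the homology of the first row into `Coker f` -/
def ι : D.H ⟶ Coker D.f := homologyComparison D.f D.g D.null ≫ ker D.τ

/-- the embedding of the homology of the second row into `Coker f'` -/
def ι' : D.H' ⟶ Coker D.f' := homologyComparison D.f' D.g' D.null' ≫ ker D.τ'

@[simp]
lemma coker_ι : coker D.σ ≫ D.ι = ker D.g ≫ coker D.f := coker_homologyComparison_ker _ _ _

@[simp]
lemma coker_ι' : coker D.σ' ≫ D.ι' = ker D.g' ≫ coker D.f' := coker_homologyComparison_ker _ _ _

lemma ι_bCheck : D.ι ≫ D.bCheck = D.h ≫ D.ι' := by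
  rw [← cancel_epi (coker D.σ), ← Category.assoc, coker_ι]
  simp

lemma ι_τ : Null (D.ι ≫ D.τ) := by
  rw [ι, Category.assoc]; exact null_left _ (ker_null D.τ)

/-- the canonical isomorphism `Ker (H ⟶ H') ⟶ Ker η` -/
def kerHη : Ker D.h ⟶ Ker D.η :=
  kerLift D.η (kerLift D.bCheck (ker D.h ≫ D.ι) (by
    rw [Category.assoc, ι_bCheck, ← Category.assoc]; exact null_right (ker_null D.h) _)) (by
    apply (ker_isKernel D.c).null_of
    rw [Category.assoc, kerMap_ker, kerLift_ker_assoc, Category.assoc]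
    exact null_left _ D.ι_τ)

lemma kerHη_ker : D.kerHη ≫ ker D.η ≫ ker D.bCheck = ker D.h ≫ D.ι := by
  simp [kerHη]

instance : IsIso D.kerHη := by
  have hx : Null ((ker D.η ≫ ker D.bCheck) ≫ D.τ) := by
    have := null_right (ker_null D.η) (ker D.c)
    simpa using this
  let y : Ker D.η ⟶ D.H :=
    kerLift D.τ (ker D.η ≫ ker D.bCheck) hx ≫ inv (homologyComparison D.f D.g D.null)
  have hy : y ≫ D.ι = ker D.η ≫ ker D.bCheck := by simp [y, ι]
  have hyh : Null (y ≫ D.h) := by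
    have h1 : Null ((y ≫ D.h) ≫ D.ι') := by
      rw [Category.assoc, ← ι_bCheck, ← Category.assoc, hy, Category.assoc]
      exact null_left _ (ker_null D.bCheck)
    rw [ι', ← Category.assoc] at h1
    have h2 := (ker_isKernel D.τ').null_of h1
    have h3 := null_right h2 (inv (homologyComparison D.f' D.g' D.null'))
    simpa using h3
  have : Mono D.ι := by unfold ι; infer_instance
  refine ⟨kerLift D.h y hyh, ?_, ?_⟩
  · rw [← cancel_mono (ker D.h), ← cancel_mono D.ι]
    simp only [Category.assoc, kerLift_ker_assoc, hy, kerHη_ker, Category.id_comp]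
  · rw [← cancel_mono (ker D.η), ← cancel_mono (ker D.bCheck)]
    simp only [Category.assoc, kerHη_ker, kerLift_ker_assoc, hy, Category.id_comp]

/-- the canonical isomorphism `Coker η' ⟶ Coker (H ⟶ H')` -/
def cokerη'H : Coker D.η' ⟶ Coker D.h :=
  cokerDesc D.η' (cokerDesc D.bHat (coker D.σ' ≫ coker D.h) (by
    have := null_left (coker D.σ) (coker_null D.h)
    simpa using this)) (by
    apply (coker_isCokernel D.a).null_of
    have := null_right (coker_null D.σ') (coker D.h)
    simpa using this)

lemma coker_cokerη'H : coker D.bHat ≫ coker D.η' ≫ D.cokerη'H = coker D.σ' ≫ coker D.h := by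
  simp [cokerη'H]

instance : IsIso D.cokerη'H := by
  have h1 : Null (D.σ' ≫ coker D.bHat ≫ coker D.η') := by
    have := null_left (coker D.a) (coker_null D.η')
    simpa using this
  have h2 : Null (D.h ≫ cokerDesc D.σ' (coker D.bHat ≫ coker D.η') h1) := by
    apply (coker_isCokernel D.σ).null_of
    have := null_right (coker_null D.bHat) (coker D.η')
    simpa using this
  refine ⟨cokerDesc D.h (cokerDesc D.σ' (coker D.bHat ≫ coker D.η') h1) h2, ?_, ?_⟩
  · rw [← cancel_epi (coker D.η'), ← cancel_epi (coker D.bHat)]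
    simp [cokerη'H]
  · rw [← cancel_epi (coker D.h), ← cancel_epi (coker D.σ')]
    simp [cokerη'H]

/-! The morphisms `ϰ : H(Ker a ⟶ Ker b ⟶ Ker c) ⟶ Ker (H ⟶ H')` and
`ϰ' : Coker (H ⟶ H') ⟶ H(Coker a ⟶ Coker b ⟶ Coker c)`. -/

/-- `lam : Ker a ⟶ Ker ξ`, induced by `Ker a ⟶ Ker b` -/
def lam : Ker D.a ⟶ Ker D.ξ := kerLift D.ξ D.fHat D.fHat_ξ

/-- `μ : Ker ξ ⟶ Ker (ξ ≫ η)`, where `ξ ≫ η = gHat` -/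
def μ : Ker D.ξ ⟶ Ker D.gHat :=
  kerLift D.gHat (ker D.ξ) (by
    rw [← ξ_η, ← Category.assoc]; exact null_right (ker_null D.ξ) _)

lemma lam_μ : D.lam ≫ D.μ = kerLift D.gHat D.fHat D.fHat_gHat := by
  rw [← cancel_mono (ker D.gHat)]; simp [lam, μ]

/-- `p : Coker lam ⟶ Coker (lam ≫ μ)` -/
def p : Coker D.lam ⟶ D.HKer :=
  cokerDesc D.lam (D.μ ≫ coker (kerLift D.gHat D.fHat D.fHat_gHat)) (by
    rw [← Category.assoc, lam_μ]; exact coker_null _)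

/-- `q : Coker (lam ≫ μ) ⟶ Coker μ` -/
def q : D.HKer ⟶ Coker D.μ :=
  cokerDesc _ (coker D.μ) (by
    rw [← lam_μ, Category.assoc]; exact null_left _ (coker_null D.μ))

/-- `vv : Ker (ξ ≫ η) ⟶ Ker η`, induced by `ξ` -/
def vv : Ker D.gHat ⟶ Ker D.η :=
  kerLift D.η (ker D.gHat ≫ D.ξ) (by
    rw [Category.assoc, ξ_η]; exact ker_null _)

/-- the morphism `Coker μ ⟶ Ker η` induced by `vv` -/
def vBar : Coker D.μ ⟶ Ker D.η :=
  cokerDesc D.μ D.vv (by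
    apply (ker_isKernel D.η).null_of
    have := ker_null D.ξ
    simpa [vv, μ] using this)

/-- `ϰ : H(Ker a ⟶ Ker b ⟶ Ker c) ⟶ Ker (H ⟶ H')` -/
def ϰ : D.HKer ⟶ Ker D.h := D.q ≫ D.vBar ≫ inv D.kerHη

/-- `lam' : Coker ξ' ⟶ Coker c`, induced by `Coker b ⟶ Coker c` -/
def lam' : Coker D.ξ' ⟶ Coker D.c := cokerDesc D.ξ' D.gCheck D.ξ'_gCheck

/-- `μ' : Coker (η' ≫ ξ') ⟶ Coker ξ'`, where `η' ≫ ξ' = fCheck` -/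
def μ' : Coker D.fCheck ⟶ Coker D.ξ' :=
  cokerDesc D.fCheck (coker D.ξ') (by
    rw [← η'_ξ', Category.assoc]; exact null_left _ (coker_null D.ξ'))

lemma μ'_lam' : D.μ' ≫ D.lam' = cokerDesc D.fCheck D.gCheck D.fCheck_gCheck := by
  rw [← cancel_epi (coker D.fCheck)]; simp [lam', μ']

/-- `p' : Ker (μ' ≫ lam') ⟶ Ker lam'` -/
def p' : RHomology D.fCheck D.gCheck D.fCheck_gCheck ⟶ Ker D.lam' :=
  kerLift D.lam' (ker (cokerDesc D.fCheck D.gCheck D.fCheck_gCheck) ≫ D.μ') (by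
    rw [Category.assoc, μ'_lam']; exact ker_null _)

/-- `q' : Ker μ' ⟶ Ker (μ' ≫ lam')` -/
def q' : Ker D.μ' ⟶ RHomology D.fCheck D.gCheck D.fCheck_gCheck :=
  kerLift _ (ker D.μ') (by
    rw [← μ'_lam', ← Category.assoc]; exact null_right (ker_null D.μ') _)

/-- `vv' : Coker η' ⟶ Coker (η' ≫ ξ')`, induced by `ξ'` -/
def vv' : Coker D.η' ⟶ Coker D.fCheck :=
  cokerDesc D.η' (D.ξ' ≫ coker D.fCheck) (by
    rw [← Category.assoc, η'_ξ']; exact coker_null _)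

/-- the morphism `Coker η' ⟶ Ker μ'` induced by `vv'` -/
def vBar' : Coker D.η' ⟶ Ker D.μ' :=
  kerLift D.μ' D.vv' (by
    apply (coker_isCokernel D.η').null_of
    have := coker_null D.ξ'
    simpa [vv', μ'] using this)

/-- `ϰ' : Coker (H ⟶ H') ⟶ H(Coker a ⟶ Coker b ⟶ Coker c)` -/
def ϰ' : Coker D.h ⟶ D.HCoker :=
  inv D.cokerη'H ≫ D.vBar' ≫ D.q' ≫ inv (homologyComparison D.fCheck D.gCheck D.fCheck_gCheck)

/-! The morphism `p₁ : Ker S ⟶ H(Ker a ⟶ Ker b ⟶ Ker c)`. -/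

lemma S₀ : CommSq D.fHat (ker D.a) (ker D.b) D.f := ⟨kerMap_ker D.S⟩

/-- the identification of `Ker ξ` with the pullback of `im f` and `im (ker b)` -/
def kerξPullback : Ker D.ξ ⟶ pullback (im D.f) (im (ker D.b)) :=
  pullback.lift (kerLift (coker D.f) (ker D.ξ ≫ ker D.b) (by
    have := null_right (ker_null D.ξ) (ker D.bCheck)
    simpa using this)) (ker D.ξ ≫ toIm (ker D.b)) (by simp)

instance : IsIso D.kerξPullback := by
  have h1 : (pullback.snd (im D.f) (im (ker D.b)) ≫ inv (toIm (ker D.b))) ≫ ker D.b =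
      pullback.fst (im D.f) (im (ker D.b)) ≫ im D.f := by
    rw [pullback.condition, Category.assoc]
    congr 1
    rw [IsIso.inv_comp_eq, toIm_im]
  have h2 : Null ((pullback.snd (im D.f) (im (ker D.b)) ≫ inv (toIm (ker D.b))) ≫ D.ξ) := by
    apply (ker_isKernel D.bCheck).null_of
    rw [Category.assoc, kerMap_ker, ← Category.assoc, h1, Category.assoc]
    exact null_left _ (ker_null _)
  refine ⟨kerLift D.ξ _ h2, ?_, ?_⟩
  · rw [← cancel_mono (ker D.ξ), Category.assoc, kerLift_ker, kerξPullback, ← Category.assoc,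
      pullback.lift_snd]
    simp
  · apply pullback.hom_ext
    · rw [Category.assoc, kerξPullback, pullback.lift_fst, ← cancel_mono (im D.f)]
      simp only [Category.assoc, kerLift_ker, kerLift_ker_assoc, Category.id_comp]
      rw [← h1, Category.assoc]
    · rw [Category.assoc, kerξPullback, pullback.lift_snd]
      simp

lemma lam_kerξPullback : D.lam ≫ D.kerξPullback = sqLam D.S₀.flip := by
  apply pullback.hom_ext
  · rw [sqLam_fst, Category.assoc, kerξPullback, pullback.lift_fst, ← cancel_mono (im D.f)]
    simp [lam]
  · rw [sqLam_snd, Category.assoc, kerξPullback, pullback.lift_snd]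
    simp [lam]

/-- the identification of `Coker lam` with `Im S₀` -/
def cokerLamIm : Coker D.lam ⟶ SqIm D.S₀.flip :=
  cokerDesc D.lam (D.kerξPullback ≫ coker (sqLam D.S₀.flip)) (by
    rw [← Category.assoc, lam_kerξPullback]; exact coker_null _)

instance : IsIso D.cokerLamIm := by
  refine ⟨cokerDesc _ (inv D.kerξPullback ≫ coker D.lam) ?_, ?_, ?_⟩
  · rw [← lam_kerξPullback]
    simpa using coker_null D.lam
  · rw [← cancel_epi (coker D.lam)]; simp [cokerLamIm]
  · rw [← cancel_epi (coker (sqLam D.S₀.flip))]; simp [cokerLamIm]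

/-- Lambek's isomorphism `Im S₀ ⟶ Ker S` of the two squares `S₀` and `S`, which are one above the
other -/
def lambekS₀S (hf : IsExact D.f) : SqIm D.S₀.flip ⟶ SqKer D.S.flip :=
  lambek D.S₀.flip D.S.flip hf (ker_null D.a) (ker_null D.b)

instance (hf : IsExact D.f) : IsIso (D.lambekS₀S hf) :=
  isIso_lambek _ _ _ _ _ (exactAt_ker _) (exactAt_ker _)

/-- `p₁ : Ker S ⟶ H(Ker a ⟶ Ker b ⟶ Ker c)` -/
def p₁ (hf : IsExact D.f) : SqKer D.S ⟶ D.HKer :=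
  sqKerFlip D.S ≫ inv (D.lambekS₀S hf) ≫ inv D.cokerLamIm ≫ D.p

/-! The morphism `p₁' : H(Coker a ⟶ Coker b ⟶ Coker c) ⟶ Im T`. -/

lemma T₀ : CommSq D.g' (coker D.b) (coker D.c) D.gCheck := ⟨(coker_cokerMap D.T).symm⟩

/-- the identification of `Coker ξ'` with the pushout of `coim g'` and `coim (coker b)` -/
def pushoutCokerξ' : pushout (coim D.g') (coim (coker D.b)) ⟶ Coker D.ξ' :=
  pushout.desc (cokerDesc (ker D.g') (coker D.b ≫ coker D.ξ') (by
    have := null_left (coker D.bHat) (coker_null D.ξ')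
    simpa using this)) (fromCoim (coker D.b) ≫ coker D.ξ') (by simp)

instance : IsIso D.pushoutCokerξ' := by
  have h1 : coker D.b ≫ inv (fromCoim (coker D.b)) ≫
      pushout.inr (coim D.g') (coim (coker D.b)) =
      coim D.g' ≫ pushout.inl (coim D.g') (coim (coker D.b)) := by
    rw [pushout.condition, ← Category.assoc]
    congr 1
    rw [IsIso.comp_inv_eq, coim_fromCoim]
  have h2 : Null (D.ξ' ≫ inv (fromCoim (coker D.b)) ≫
      pushout.inr (coim D.g') (coim (coker D.b))) := by
    apply (coker_isCokernel D.bHat).null_of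
    rw [coker_cokerMap_assoc, h1, ← Category.assoc]
    exact null_right (coker_null _) _
  refine ⟨cokerDesc D.ξ' _ h2, ?_, ?_⟩
  · apply pushout.hom_ext
    · rw [← Category.assoc, pushoutCokerξ', pushout.inl_desc, ← cancel_epi (coim D.g')]
      simp only [coker_cokerDesc_assoc, Category.assoc, coker_cokerDesc, Category.comp_id]
      rw [h1]
    · rw [← Category.assoc, pushoutCokerξ', pushout.inr_desc, Category.assoc, coker_cokerDesc,
        IsIso.hom_inv_id_assoc, Category.comp_id]
  · rw [← cancel_epi (coker D.ξ'), coker_cokerDesc_assoc, Category.assoc, pushoutCokerξ',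
      pushout.inr_desc, IsIso.inv_hom_id_assoc, Category.comp_id]

lemma pushoutCokerξ'_lam' : D.pushoutCokerξ' ≫ D.lam' = sqRho D.T₀.flip := by
  apply pushout.hom_ext
  · rw [inl_sqRho, ← Category.assoc, pushoutCokerξ', pushout.inl_desc, ← cancel_epi (coim D.g')]
    simp [lam']
  · rw [inr_sqRho, ← Category.assoc, pushoutCokerξ', pushout.inr_desc]
    simp [lam']

/-- the identification of `Ker T₀` with `Ker lam'` -/
def kerLam' : SqKer D.T₀.flip ⟶ Ker D.lam' :=
  kerLift D.lam' (ker (sqRho D.T₀.flip) ≫ D.pushoutCokerξ') (by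
    rw [Category.assoc, pushoutCokerξ'_lam']; exact ker_null _)

instance : IsIso D.kerLam' := by
  refine ⟨kerLift _ (ker D.lam' ≫ inv D.pushoutCokerξ') ?_, ?_, ?_⟩
  · rw [← pushoutCokerξ'_lam']
    simpa using ker_null D.lam'
  · rw [← cancel_mono (ker (sqRho D.T₀.flip))]; simp [kerLam']
  · rw [← cancel_mono (ker D.lam')]; simp [kerLam']

/-- Lambek's isomorphism `Im T ⟶ Ker T₀` of the two squares `T` and `T₀`, which are one above the
other -/
def lambekTT₀ (hg' : IsExact D.g') : SqIm D.T.flip ⟶ SqKer D.T₀.flip :=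
  lambek D.T.flip D.T₀.flip hg' (coker_null D.b) (coker_null D.c)

instance (hg' : IsExact D.g') : IsIso (D.lambekTT₀ hg') :=
  isIso_lambek _ _ _ _ _ (exactAt_coker _) (exactAt_coker _)

/-- `p₁' : H(Coker a ⟶ Coker b ⟶ Coker c) ⟶ Im T` -/
def p₁' (hg' : IsExact D.g') : D.HCoker ⟶ SqIm D.T :=
  homologyComparison D.fCheck D.gCheck D.fCheck_gCheck ≫ D.p' ≫ inv D.kerLam' ≫
    inv (D.lambekTT₀ hg') ≫ sqImFlip D.T.flip

/-! The morphism `β : Ker (H ⟶ H') ⟶ Im S`. -/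

/-- Lambek's morphism `Λ : Im S ⟶ Ker T` -/
def Λ (hb : IsExact D.b) : SqIm D.S ⟶ SqKer D.T := lambek D.S D.T hb D.null D.null'

/-- Lambek's isomorphism `Im S ⟶ Ker S₁` of the two consecutive squares `S` and `S₁` -/
def lambekSS₁ (hb : IsExact D.b) : SqIm D.S ⟶ SqKer D.S₁ :=
  lambek D.S D.S₁ hb (coker_null D.f) (coker_null D.f')

instance (hb : IsExact D.b) : IsIso (D.lambekSS₁ hb) :=
  isIso_lambek _ _ _ _ _ (exactAt_coker _) (exactAt_coker _)

/-- Lambek's isomorphism `Im S₂ ⟶ Ker S₁` of the two squares `S₂` and `S₁`, which are one above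
the other -/
def lambekS₂S₁ : SqIm D.S₂.flip ⟶ SqKer D.S₁.flip :=
  lambek D.S₂.flip D.S₁.flip (isExact_coker D.f) (ker_null D.b) (ker_null D.bCheck)

/-- the identification of `Coker ξ` with `Im S₂` -/
def cokerξIm : Coker D.ξ ⟶ SqIm D.S₂.flip :=
  cokerDesc D.ξ (pullback.lift
    (kerLift (coker (coker D.f)) (ker D.bCheck) (null_left _ (null_coker_coker D.f)))
    (toIm (ker D.bCheck)) (by simp) ≫ coker (sqLam D.S₂.flip)) (by
    have : D.ξ ≫ pullback.lift
        (kerLift (coker (coker D.f)) (ker D.bCheck) (null_left _ (null_coker_coker D.f)))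
        (toIm (ker D.bCheck)) (by simp) = sqLam D.S₂.flip := by
      apply pullback.hom_ext
      · rw [sqLam_fst, Category.assoc, pullback.lift_fst, ← cancel_mono (im (coker D.f))]
        simp
      · rw [sqLam_snd, Category.assoc, pullback.lift_snd]
    rw [← Category.assoc, this]
    exact coker_null _)

/-- `β : Ker (H ⟶ H') ⟶ Im S`: the composite of `Ker η ⟶ Coker ξ` with the identifications of
`Ker (H ⟶ H')` with `Ker η` and of `Coker ξ` with `Im S₂`, `Ker S₁` and `Im S` -/
def β (hb : IsExact D.b) : Ker D.h ⟶ SqIm D.S :=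
  D.kerHη ≫ (ker D.η ≫ coker D.ξ) ≫ D.cokerξIm ≫ D.lambekS₂S₁ ≫ sqKerFlip D.S₁.flip ≫
    inv (D.lambekSS₁ hb)

/-! The morphism `β' : Ker T ⟶ Coker (H ⟶ H')`. -/

/-- Lambek's isomorphism `Im T₁ ⟶ Ker T` of the two consecutive squares `T₁` and `T` -/
def lambekT₁T (hb : IsExact D.b) : SqIm D.T₁ ⟶ SqKer D.T :=
  lambek D.T₁ D.T hb (ker_null D.g) (ker_null D.g')

instance (hb : IsExact D.b) : IsIso (D.lambekT₁T hb) :=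
  isIso_lambek _ _ _ _ _ (exactAt_ker _) (exactAt_ker _)

/-- Lambek's isomorphism `Im T₁ ⟶ Ker T₂` of the two squares `T₁` and `T₂`, which are one above
the other -/
def lambekT₁T₂ : SqIm D.T₁.flip ⟶ SqKer D.T₂.flip :=
  lambek D.T₁.flip D.T₂.flip (isExact_ker D.g') (coker_null D.bHat) (coker_null D.b)

/-- the identification of `Ker T₂` with `Ker ξ'` -/
def kerξ' : SqKer D.T₂.flip ⟶ Ker D.ξ' :=
  kerLift D.ξ' (ker (sqRho D.T₂.flip) ≫ pushout.desc
    (cokerDesc (ker (ker D.g')) (coker D.bHat) (null_right (null_ker_ker D.g') _))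
    (fromCoim (coker D.bHat)) (by simp)) (by
    have : pushout.desc
        (cokerDesc (ker (ker D.g')) (coker D.bHat) (null_right (null_ker_ker D.g') _))
        (fromCoim (coker D.bHat)) (by simp) ≫ D.ξ' = sqRho D.T₂.flip := by
      apply pushout.hom_ext
      · rw [inl_sqRho, ← Category.assoc, pushout.inl_desc, ← cancel_epi (coim (ker D.g'))]
        simp
      · rw [inr_sqRho, ← Category.assoc, pushout.inr_desc]
    rw [Category.assoc, this]
    exact ker_null _)

/-- `β' : Ker T ⟶ Coker (H ⟶ H')`: the composite of `Ker ξ' ⟶ Coker η'` with the identifications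
of `Ker T` with `Im T₁`, `Ker T₂` and `Ker ξ'`, and of `Coker η'` with `Coker (H ⟶ H')` -/
def β' (hb : IsExact D.b) : SqKer D.T ⟶ Coker D.h :=
  inv (D.lambekT₁T hb) ≫ sqImFlip D.T₁ ≫ D.lambekT₁T₂ ≫ D.kerξ' ≫ (ker D.ξ' ≫ coker D.η') ≫
    D.cokerη'H

end Diagram

end
end Nomura

/-! Everything reduces to a composite of two morphisms. The kernel row factors as `gHat = ξ ≫ η`,
and up to canonical isomorphisms `β` is `ker η ≫ coker ξ`; dually `fCheck = η' ≫ ξ'`, and `β'` is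
`ker ξ' ≫ coker η'`.

At the left end, `Ker a` maps to `Ker ξ`, which is a subobject of `Ker gHat`. By the third
isomorphism theorem (`IsKernel.quotient`, a form of the coincidence of left and right homology,
`isIso_comparison`), `p` is a kernel of `q`, the projection of `HKer` onto `Coker μ`. What remains
of `ϰ` after `q` comes from the coimage of the restriction `vv` of `ξ`, and such a morphism reflects
null morphisms. Hence `p`, and with it `p₁`, is a kernel of `ϰ`.

The conditional statements rest on `exact_ker_comp` and its dual `exact_comp_coker`: for an exact
morphism, the induced morphism on kernels (resp. cokernels) of a composite is exact, and the
sequence it forms with `ker η ≫ coker ξ` is exact at the middle object. For `ϰ` this applies to `ξ`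
itself, which is exact because composing it with the kernel `ker bCheck` gives `ker b ≫ coker f`.

For `Λ` the key is an auxiliary morphism `kerToCoim : Ker bCheck ⟶ Coim g`. It has the same kernel
as `η`, its composite with `ξ` is `ker b ≫ coim g`, and the cokernel of that composite is the
coprojection into the pushout that defines `Ker T`. Following Lambek's isomorphisms shows that `Λ`,
read from `Coker ξ` to this pushout, is exactly the morphism induced by `kerToCoim` on cokernels
(`coker_cokerξSqIm_Λ_ker`). So `exact_comp_coker` applies as soon as `kerToCoim` is exact, which
follows from exactness of `g` and `η`. The dual half uses `imToCoker` and `exact_ker_comp`. -/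

namespace Nomura

universe v u

variable {𝒞 : Type u} [Category.{v} 𝒞]

/-! ### Calculus of kernels and cokernels relative to the null ideal -/

section Kernels

variable [NullCategory 𝒞] {V W X Y Z : 𝒞}

lemma IsKernel.of_mono {f : X ⟶ Y} {k : W ⟶ X} [Mono k] (h : Null (k ≫ f))
    (lift : ∀ {V : 𝒞} (x : V ⟶ X), Null (x ≫ f) → ∃ x' : V ⟶ W, x' ≫ k = x) : IsKernel f k :=
  ⟨h, fun x hx => by
    obtain ⟨y, hy⟩ := lift x hx
    exact ⟨y, hy, fun z hz => by rwa [← cancel_mono k, hy]⟩⟩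

lemma IsCokernel.of_epi {f : X ⟶ Y} {l : Y ⟶ W} [Epi l] (h : Null (f ≫ l))
    (desc : ∀ {V : 𝒞} (x : Y ⟶ V), Null (f ≫ x) → ∃ x' : W ⟶ V, l ≫ x' = x) : IsCokernel f l :=
  ⟨h, fun x hx => by
    obtain ⟨y, hy⟩ := desc x hx
    exact ⟨y, hy, fun z hz => by rwa [← cancel_epi l, hy]⟩⟩

lemma IsKernel.iso_comp {f : X ⟶ Y} {k : W ⟶ X} (h : IsKernel f k) (e : V ⟶ W) [IsIso e] :
    IsKernel f (e ≫ k) := by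
  have := h.mono
  refine .of_mono (by rw [Category.assoc]; exact null_left e h.null) fun x hx => ?_
  obtain ⟨y, hy, -⟩ := h.lift x hx
  exact ⟨y ≫ inv e, by simp [hy]⟩

lemma IsCokernel.comp_iso {f : X ⟶ Y} {l : Y ⟶ W} (h : IsCokernel f l) (e : W ⟶ V) [IsIso e] :
    IsCokernel f (l ≫ e) := by
  have := h.epi
  refine .of_epi (by rw [← Category.assoc]; exact null_right h.null e) fun x hx => ?_
  obtain ⟨y, hy, -⟩ := h.desc x hx
  exact ⟨inv e ≫ y, by simp [hy]⟩

/-- Reflecting null morphisms is weaker than being a monomorphism, yet it is all that kernels see.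
This matters for `fromCoim` and `vBar`, which reflect null morphisms but need not be monic. -/
lemma IsKernel.comp_of_null {f : X ⟶ Y} {k : W ⟶ X} (h : IsKernel f k) (e : Y ⟶ Z)
    (he : ∀ {V : 𝒞} (x : V ⟶ Y), Null (x ≫ e) → Null x) : IsKernel (f ≫ e) k :=
  ⟨by rw [← Category.assoc]; exact null_right h.null e,
    fun x hx => h.lift x (he _ (by rwa [Category.assoc]))⟩

lemma IsCokernel.comp_of_null {f : X ⟶ Y} {l : Y ⟶ W} (h : IsCokernel f l) (e : Z ⟶ X)
    (he : ∀ {V : 𝒞} (x : X ⟶ V), Null (e ≫ x) → Null x) : IsCokernel (e ≫ f) l :=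
  ⟨by rw [Category.assoc]; exact null_left e h.null,
    fun x hx => h.desc x (he _ (by rwa [← Category.assoc]))⟩

lemma IsKernel.of_comp {f : X ⟶ Y} {e : Y ⟶ Z} {k : W ⟶ X} (h : IsKernel (f ≫ e) k)
    (he : ∀ {V : 𝒞} (x : V ⟶ Y), Null (x ≫ e) → Null x) : IsKernel f k :=
  ⟨he _ (by rw [Category.assoc]; exact h.null),
    fun x hx => h.lift x (by rw [← Category.assoc]; exact null_right hx e)⟩

lemma IsCokernel.of_comp {f : X ⟶ Y} {e : Z ⟶ X} {l : Y ⟶ W} (h : IsCokernel (e ≫ f) l)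
    (he : ∀ {V : 𝒞} (x : X ⟶ V), Null (e ≫ x) → Null x) : IsCokernel f l :=
  ⟨he _ (by rw [← Category.assoc]; exact h.null),
    fun x hx => h.desc x (by rw [Category.assoc]; exact null_left e hx)⟩

lemma null_of_null_comp_iso {f : X ⟶ Y} (e : Y ⟶ Z) [IsIso e] (h : Null (f ≫ e)) : Null f := by
  simpa using null_right h (inv e)

lemma null_of_null_iso_comp {f : X ⟶ Y} (e : Z ⟶ X) [IsIso e] (h : Null (e ≫ f)) : Null f := by
  simpa using null_left (inv e) h

lemma IsKernel.comp_iso {f : X ⟶ Y} {k : W ⟶ X} (h : IsKernel f k) (e : X ⟶ V) [IsIso e]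
    {g : V ⟶ Y} (hg : e ≫ g = f) : IsKernel g (k ≫ e) := by
  subst hg
  have := h.mono
  refine .of_mono (by rw [Category.assoc]; exact h.null) fun x hx => ?_
  obtain ⟨y, hy, -⟩ := h.lift (x ≫ inv e) (by simpa using hx)
  exact ⟨y, by rw [← Category.assoc, hy]; simp⟩

lemma IsCokernel.iso_comp {f : X ⟶ Y} {l : Y ⟶ W} (h : IsCokernel f l) (e : V ⟶ Y) [IsIso e]
    {g : X ⟶ V} (hg : g ≫ e = f) : IsCokernel g (e ≫ l) := by
  subst hg
  have := h.epi
  refine .of_epi (by rw [← Category.assoc]; exact h.null) fun x hx => ?_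
  obtain ⟨y, hy, -⟩ := h.desc (inv e ≫ x) (by simpa using hx)
  exact ⟨y, by rw [Category.assoc, hy]; simp⟩

/-- the kernel of `x ≫ f` is the inverse image of the kernel of `f` along the kernel `x` -/
lemma IsKernel.pullback {f : X ⟶ Y} {x : Z ⟶ X} {k : W ⟶ X} {m : V ⟶ Z} {n : V ⟶ W}
    (hk : IsKernel f k) (hm : IsKernel (x ≫ f) m) (e : n ≫ k = m ≫ x)
    {U : 𝒞} {g : X ⟶ U} (hx : IsKernel g x) : IsKernel (k ≫ g) n := by
  have := hk.mono
  have := hm.mono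
  have := hx.mono
  have : Mono (n ≫ k) := by rw [e]; infer_instance
  have : Mono n := mono_of_mono n k
  refine .of_mono ?_ fun y hy => ?_
  · rw [← Category.assoc, e, Category.assoc]; exact null_left m hx.null
  · obtain ⟨z, hz, -⟩ := hx.lift (y ≫ k) (by rwa [Category.assoc])
    obtain ⟨w, hw, -⟩ := hm.lift z (by
      rw [← Category.assoc, hz, Category.assoc]; exact null_left y hk.null)
    exact ⟨w, by rw [← cancel_mono k, Category.assoc, e, ← Category.assoc, hw, hz]⟩

/-- the cokernel of `f ≫ x` is the direct image of the cokernel of `f` along the cokernel `x` -/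
lemma IsCokernel.pushout {f : X ⟶ Y} {x : Y ⟶ Z} {k : Y ⟶ W} {m : Z ⟶ V} {n : W ⟶ V}
    (hk : IsCokernel f k) (hm : IsCokernel (f ≫ x) m) (e : k ≫ n = x ≫ m)
    {U : 𝒞} {g : U ⟶ Y} (hx : IsCokernel g x) : IsCokernel (g ≫ k) n := by
  have := hk.epi
  have := hm.epi
  have := hx.epi
  have : Epi (k ≫ n) := by rw [e]; infer_instance
  have : Epi n := epi_of_epi k n
  refine .of_epi ?_ fun y hy => ?_
  · rw [Category.assoc, e, ← Category.assoc]; exact null_right hx.null m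
  · obtain ⟨z, hz, -⟩ := hx.desc (k ≫ y) (by rwa [← Category.assoc])
    obtain ⟨w, hw, -⟩ := hm.desc z (by
      rw [Category.assoc, hz, ← Category.assoc]; exact null_right hk.null y)
    exact ⟨w, by rw [← cancel_epi k, ← Category.assoc, e, Category.assoc, hw, hz]⟩

end Kernels

/-! ### Exact morphisms and exact sequences: factorization and cancellation -/

section Exactness

variable [HomologicalCategory 𝒞] {U V W X Y Z : 𝒞}

lemma IsKernel.congr {f : X ⟶ Y} {g : X ⟶ Z} {k : V ⟶ X} {k' : W ⟶ X} (h : IsKernel f k)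
    (h' : IsKernel f k') (hg : IsKernel g k) : IsKernel g k' := by
  obtain ⟨t, ht, -⟩ := h.lift k' h'.null
  have := h'.isIso h ht
  rw [← ht]
  exact hg.iso_comp t

lemma IsSomeKernel.isKernel {k : W ⟶ X} (h : IsSomeKernel k) : IsKernel (coker k) k :=
  h.choose_spec.choose_spec.of_cokernel (coker_isCokernel k)

lemma IsSomeCokernel.isCokernel {l : X ⟶ W} (h : IsSomeCokernel l) : IsCokernel (ker l) l :=
  h.choose_spec.choose_spec.of_kernel (ker_isKernel l)

lemma IsKernel.some {f : X ⟶ Y} {k : W ⟶ X} (h : IsKernel f k) : IsSomeKernel k := ⟨_, _, h⟩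

lemma IsCokernel.some {f : X ⟶ Y} {l : Y ⟶ W} (h : IsCokernel f l) : IsSomeCokernel l :=
  ⟨_, _, h⟩

lemma isSomeKernel_of_isIso (e : X ⟶ Y) [IsIso e] : IsSomeKernel e := by
  refine ⟨_, coker e, coker_null e, fun x _ => ⟨x ≫ inv e, by simp, fun z hz => by simp [← hz]⟩⟩

lemma isSomeCokernel_of_isIso (e : X ⟶ Y) [IsIso e] : IsSomeCokernel e := by
  refine ⟨_, ker e, ker_null e, fun x _ => ⟨inv e ≫ x, by simp, fun z hz => by simp [← hz]⟩⟩

lemma IsSomeKernel.of_comp {x : U ⟶ V} {k : V ⟶ W} (h : IsSomeKernel (x ≫ k))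
    (hk : IsSomeKernel k) : IsSomeKernel x := by
  have := hk.isKernel.mono
  have := h.isKernel.mono
  have := mono_of_mono x k
  refine ⟨_, k ≫ coker (x ≫ k), .of_mono (by rw [← Category.assoc]; exact coker_null _)
    fun y hy => ?_⟩
  obtain ⟨z, hz, -⟩ := h.isKernel.lift (y ≫ k) (by rwa [Category.assoc])
  exact ⟨z, by rw [← cancel_mono k, Category.assoc, hz]⟩

lemma IsSomeCokernel.of_comp {x : V ⟶ U} {l : W ⟶ V} (h : IsSomeCokernel (l ≫ x))
    (hl : IsSomeCokernel l) : IsSomeCokernel x := by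
  have := hl.isCokernel.epi
  have := h.isCokernel.epi
  have := epi_of_epi l x
  refine ⟨_, ker (l ≫ x) ≫ l, .of_epi (by rw [Category.assoc]; exact ker_null _) fun y hy => ?_⟩
  obtain ⟨z, hz, -⟩ := h.isCokernel.desc (l ≫ y) (by rwa [← Category.assoc])
  exact ⟨z, by rw [← cancel_epi l, ← Category.assoc, hz]⟩

/-- Precomposing with a cokernel changes neither which composites are null nor, therefore, the
cokernel. -/
lemma isCokernel_im_of_factor {p : X ⟶ Z} {i : Z ⟶ Y} (hp : IsSomeCokernel p) :
    IsCokernel i (coker (p ≫ i)) :=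
  (coker_isCokernel (p ≫ i)).of_comp fun _ hx => hp.isCokernel.null_of hx

lemma isKernel_coim_of_factor {p : X ⟶ Z} {i : Z ⟶ Y} (hi : IsSomeKernel i) :
    IsKernel p (ker (p ≫ i)) :=
  (ker_isKernel (p ≫ i)).of_comp fun _ hx => hi.isKernel.null_of hx

/-- A morphism that factors as a cokernel followed by a kernel is exact. -/
lemma isExact_of_factor {p : X ⟶ Z} {i : Z ⟶ Y} (hp : IsSomeCokernel p) (hi : IsSomeKernel i) :
    IsExact (p ≫ i) := by
  -- `i` serves as an image and `p` as a coimage of the composite, so uniqueness of kernels and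
  -- cokernels gives isomorphisms `s : Coim ⟶ Z` and `t : Z ⟶ Im` whose composite is the middle
  -- morphism.
  have h1 : IsKernel (coker (p ≫ i)) i := hi.isKernel.of_cokernel (isCokernel_im_of_factor hp)
  have h2 : IsCokernel (ker (p ≫ i)) p := hp.isCokernel.of_kernel (isKernel_coim_of_factor hi)
  obtain ⟨s, hs, -⟩ := (coker_isCokernel (ker (p ≫ i))).desc p h2.null
  obtain ⟨t, ht, -⟩ := (ker_isKernel (coker (p ≫ i))).lift i h1.null
  have := (coker_isCokernel (ker (p ≫ i))).isIso h2 hs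
  have := h1.isIso (ker_isKernel (coker (p ≫ i))) ht
  have : mid (p ≫ i) = s ≫ t := by
    rw [← cancel_epi (coim (p ≫ i)), ← cancel_mono (im (p ≫ i)), coim_mid, toIm_im]
    simp only [Category.assoc, ht]
    rw [← Category.assoc, hs]
  rw [IsExact, this]
  infer_instance

lemma IsExact.isSomeKernel_fromCoim {f : X ⟶ Y} (hf : IsExact f) : IsSomeKernel (fromCoim f) := by
  have : IsIso (mid f) := hf
  exact ((ker_isKernel (coker f)).iso_comp (mid f)).some

lemma IsExact.isSomeCokernel_toIm {f : X ⟶ Y} (hf : IsExact f) : IsSomeCokernel (toIm f) := by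
  have : IsIso (mid f) := hf
  rw [← coim_mid]
  exact ((coker_isCokernel (ker f)).comp_iso (mid f)).some

lemma IsExact.comp_kernel {f : X ⟶ Y} (hf : IsExact f) {k : Y ⟶ Z} (hk : IsSomeKernel k) :
    IsExact (f ≫ k) := by
  rw [← toIm_im f, Category.assoc]
  exact isExact_of_factor hf.isSomeCokernel_toIm
    (HomologicalCategory.ker_comp _ _ (ker_isKernel _).some hk)

lemma IsExact.cokernel_comp {f : X ⟶ Y} (hf : IsExact f) {l : Z ⟶ X} (hl : IsSomeCokernel l) :
    IsExact (l ≫ f) := by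
  rw [← coim_fromCoim f, ← Category.assoc]
  exact isExact_of_factor (HomologicalCategory.coker_comp _ _ hl (coker_isCokernel _).some)
    hf.isSomeKernel_fromCoim

/-- The image of `f ≫ k` lies inside the subobject `k`. Cancelling `k` turns the cokernel-kernel
factorization of `f ≫ k` into one of `f`. -/
lemma IsExact.of_comp_kernel {f : X ⟶ Y} {k : Y ⟶ Z} (h : IsExact (f ≫ k))
    (hk : IsSomeKernel k) : IsExact f := by
  obtain ⟨i, hi, -⟩ := hk.isKernel.lift (im (f ≫ k)) (im_null (by
    rw [Category.assoc]; exact null_left f hk.isKernel.null))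
  have := hk.isKernel.mono
  have hf : toIm (f ≫ k) ≫ i = f := by rw [← cancel_mono k, Category.assoc, hi, toIm_im]
  rw [← hf]
  exact isExact_of_factor h.isSomeCokernel_toIm
    (IsSomeKernel.of_comp (hi.symm ▸ (ker_isKernel _).some) hk)

lemma IsExact.of_cokernel_comp {f : X ⟶ Y} {l : Z ⟶ X} (h : IsExact (l ≫ f))
    (hl : IsSomeCokernel l) : IsExact f := by
  obtain ⟨p, hp, -⟩ := hl.isCokernel.desc (coim (l ≫ f)) (null_coim (by
    rw [← Category.assoc]; exact null_right hl.isCokernel.null f))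
  have := hl.isCokernel.epi
  have hf : p ≫ fromCoim (l ≫ f) = f := by
    rw [← cancel_epi l, ← Category.assoc, hp, coim_fromCoim]
  rw [← hf]
  exact isExact_of_factor
    (IsSomeCokernel.of_comp (hp.symm ▸ (coker_isCokernel _).some) hl) h.isSomeKernel_fromCoim

/-- The image of `p ≫ i` is `i` up to isomorphism, since `p` does not affect the cokernel. -/
lemma exactAt_of_factor {p : W ⟶ X} {i : X ⟶ Y} {g : Y ⟶ Z} (hp : IsSomeCokernel p)
    (hi : IsKernel g i) : ExactAt (p ≫ i) g :=
  (hi.some.isKernel.of_cokernel (isCokernel_im_of_factor hp)).congr (ker_isKernel _) hi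

/-- the kernel of one cokernel of `f` is the kernel of every cokernel of `f` -/
lemma IsCokernel.isKernel_of_isKernel {f : X ⟶ Y} {l : Y ⟶ V} {l' : Y ⟶ W} {k : U ⟶ Y}
    (h : IsCokernel f l) (h' : IsCokernel f l') (hk : IsKernel l k) : IsKernel l' k := by
  obtain ⟨t, ht, -⟩ := h'.desc l h.null
  obtain ⟨s, hs, -⟩ := h.desc l' h'.null
  rw [← ht] at hk
  refine ⟨?_, fun x hx => hk.lift x (by rw [← Category.assoc]; exact null_right hx t)⟩
  rw [← hs, ← Category.assoc, ← ht]; exact null_right hk.null s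

lemma exactAt_of_isCokernel {f : X ⟶ Y} {p : Y ⟶ W} {i : W ⟶ Z} (hp : IsCokernel f p)
    (hi : IsSomeKernel i) : ExactAt f (p ≫ i) :=
  ((coker_isCokernel f).isKernel_of_isKernel hp (ker_isKernel _)).comp_of_null i
    fun _ hx => hi.isKernel.null_of hx

/-- Exactness only involves the image of the first morphism, and that image is unchanged when a
cokernel in front is removed. -/
lemma ExactAt.of_cokernel_comp {l : W ⟶ X} {f : X ⟶ Y} {g : Y ⟶ Z} (h : ExactAt (l ≫ f) g)
    (hl : IsSomeCokernel l) : ExactAt f g :=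
  ((isCokernel_im_of_factor hl).isKernel_of_isKernel (coker_isCokernel f)
    (ker_isKernel _)).congr (ker_isKernel _) h

lemma ExactAt.comp_iso {f : X ⟶ Y} {g : Y ⟶ Z} (h : ExactAt f g) (e : Y ⟶ V) [IsIso e]
    {g' : V ⟶ Z} (hg : e ≫ g' = g) : ExactAt (f ≫ e) g' := by
  have h1 : IsKernel g' (im f ≫ e) := IsKernel.comp_iso h e hg
  have h2 : IsCokernel (f ≫ e) (inv e ≫ coker f) :=
    (coker_isCokernel f).iso_comp (inv e) (by simp)
  exact ((h2.isKernel_of_isKernel (coker_isCokernel _)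
    ((ker_isKernel (coker f)).comp_iso e (by simp))).congr (ker_isKernel _) h1)

lemma ExactAt.postcomp_iso {f : X ⟶ Y} {g : Y ⟶ Z} (h : ExactAt f g) (e : Z ⟶ V) [IsIso e] :
    ExactAt f (g ≫ e) :=
  IsKernel.comp_of_null h e fun _ => null_of_null_comp_iso e

/-- The morphism `t` induced by the kernel `ι` on the cokernels of `y` and `y ≫ ι` is a kernel. -/
lemma IsKernel.quotient {J M K I L : 𝒞} {y : J ⟶ I} {c : I ⟶ M} {ι : I ⟶ X} {k : X ⟶ K}
    {q : K ⟶ L} {t : M ⟶ K} (hι : IsKernel (k ≫ q) ι) (hc : IsCokernel y c)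
    (hk : IsCokernel (y ≫ ι) k) (ht : c ≫ t = ι ≫ k) : IsKernel q t := by
  have := hc.epi
  obtain ⟨w, hw, -⟩ := (ker_isKernel q).lift t (hc.null_of (by
    rw [← Category.assoc, ht, Category.assoc]; exact hι.null))
  -- The null sequence `y ≫ ι`, `k ≫ q` has left homology `M` and right homology `Ker q`; the
  -- comparison between them is `w`.
  have := isIso_comparison hι hk rfl rfl hc (ker_isKernel q) (m := w) (by rw [hw, ht])
  rw [← hw]
  exact (ker_isKernel q).iso_comp w

/-- The morphism `t` induced by the cokernel `π` on the kernels of `π ≫ s` and `s` is a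
cokernel. -/
lemma IsCokernel.restrict {J M K I L : 𝒞} {π : X ⟶ I} {s : I ⟶ J} {k : K ⟶ X}
    {m : M ⟶ I} {t : K ⟶ M} {q : L ⟶ K} (hπ : IsCokernel (q ≫ k) π) (hk : IsKernel (π ≫ s) k)
    (hm : IsKernel s m) (ht : t ≫ m = k ≫ π) : IsCokernel q t := by
  have := hm.mono
  obtain ⟨w, hw, -⟩ := (coker_isCokernel q).desc t (hm.null_of (by
    rw [Category.assoc, ht, ← Category.assoc]; exact hπ.null))
  -- Here the null sequence is `q ≫ k`, `π ≫ s`, with left homology `Coker q` and right homology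
  -- `M`.
  have := isIso_comparison hk hπ rfl rfl (coker_isCokernel q) hm (m := w) (by
    rw [← Category.assoc, hw, ht])
  rw [← hw]
  exact (coker_isCokernel q).comp_iso w

/-- The restriction of an exact morphism `ξ` to the kernels of `ξ ≫ η` and of `η` is exact. -/
lemma exact_ker_comp {K L M N : 𝒞} {ξ : X ⟶ K} {η : K ⟶ Y} {k : M ⟶ X} {j : N ⟶ K} {l : K ⟶ L}
    {v : M ⟶ N} (hξ : IsExact ξ) (hl : IsCokernel ξ l) (hj : IsKernel η j)
    (hk : IsKernel (ξ ≫ η) k) (hv : v ≫ j = k ≫ ξ) : IsExact v ∧ ExactAt v (j ≫ l) := by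
  -- Exactness of `ξ` enters here: `fromCoim ξ` is a kernel, and it has the same cokernel `l` as
  -- `ξ`.
  have hι : IsKernel l (fromCoim ξ) := hξ.isSomeKernel_fromCoim.isKernel.of_cokernel
    (IsCokernel.of_comp (e := coim ξ) (by rwa [coim_fromCoim])
      fun _ hx => (coker_isCokernel _).null_of hx)
  have hk' : IsKernel (coim ξ ≫ fromCoim ξ ≫ η) k := by
    rwa [← Category.assoc, coim_fromCoim]
  have hm := ker_isKernel (fromCoim ξ ≫ η)
  obtain ⟨t, ht, -⟩ := hm.lift (k ≫ coim ξ) (by rw [Category.assoc]; exact hk'.null)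
  obtain ⟨n, hn, -⟩ := hj.lift (ker (fromCoim ξ ≫ η) ≫ fromCoim ξ) (by
    rw [Category.assoc (ker _)]; exact hm.null)
  obtain ⟨q, hq, -⟩ := hk'.lift (ker ξ) (by
    rw [← Category.assoc (coim ξ), coim_fromCoim, ← Category.assoc]
    exact null_right (ker_null ξ) η)
  -- The factorization of `v`: `t` is the restriction of the cokernel `coim ξ`, hence a cokernel,
  -- and `n` is the inverse image along `j` of the subobject `fromCoim ξ`, hence a kernel of `j ≫
  -- l`.
  have ht' : IsCokernel q t :=
    IsCokernel.restrict (by rw [hq]; exact coker_isCokernel _) hk' hm ht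
  have hn' : IsKernel (j ≫ l) n := hj.pullback hm hn hι
  have := hj.mono
  have hv' : t ≫ n = v := by
    rw [← cancel_mono j, Category.assoc, hn, ← Category.assoc, ht, Category.assoc,
      coim_fromCoim, hv]
  rw [← hv']
  exact ⟨isExact_of_factor ht'.some hn'.some, exactAt_of_factor ht'.some hn'⟩

/-- The morphism induced by an exact morphism `ξ` on the cokernels of `η` and of `η ≫ ξ` is
exact. -/
lemma exact_comp_coker {K L M N : 𝒞} {ξ : K ⟶ X} {η : Y ⟶ K} {k : X ⟶ M} {j : K ⟶ N} {l : L ⟶ K}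
    {v : N ⟶ M} (hξ : IsExact ξ) (hl : IsKernel ξ l) (hj : IsCokernel η j)
    (hk : IsCokernel (η ≫ ξ) k) (hv : j ≫ v = ξ ≫ k) : IsExact v ∧ ExactAt (l ≫ j) v := by
  have hπ : IsCokernel l (toIm ξ) := hξ.isSomeCokernel_toIm.isCokernel.of_kernel
    (IsKernel.of_comp (e := im ξ) (by rwa [toIm_im])
      fun _ hx => (ker_isKernel _).null_of hx)
  have hk' : IsCokernel ((η ≫ toIm ξ) ≫ im ξ) k := by
    rwa [Category.assoc, toIm_im]
  have hm := coker_isCokernel (η ≫ toIm ξ)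
  obtain ⟨t, ht, -⟩ := hm.desc (im ξ ≫ k) (by rw [← Category.assoc]; exact hk'.null)
  obtain ⟨n, hn, -⟩ := hj.desc (toIm ξ ≫ coker (η ≫ toIm ξ)) (by
    rw [← Category.assoc]; exact hm.null)
  obtain ⟨q, hq, -⟩ := hk'.desc (coker ξ) (by
    simpa using null_left η (coker_null ξ))
  have ht' : IsKernel q t :=
    IsKernel.quotient (by rw [hq]; exact ker_isKernel _) hm hk' ht
  -- Now the first factor `n` is the direct image of the cokernel `toIm ξ` along `j`, and the second
  -- factor `t` is the quotient of the kernel `im ξ`.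
  have hn' : IsCokernel (l ≫ j) n := hj.pushout hm hn hπ
  have := hj.epi
  have hv' : n ≫ t = v := by
    rw [← cancel_epi j, ← Category.assoc, hn, Category.assoc, ht, ← Category.assoc,
      toIm_im, hv]
  rw [← hv']
  exact ⟨isExact_of_factor hn'.some ht'.some, exactAt_of_isCokernel hn' ht'.some⟩

end Exactness

/-! ### Transposing a square; projections of its pullback and pushout -/

section Square

variable [SemiexactCategory 𝒞] {V W X Y Z : 𝒞} {f : X ⟶ Y} {a : X ⟶ V} {b : Y ⟶ W} {g : V ⟶ W}

lemma coker_sqImFlip (S : CommSq f a b g) :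
    coker (sqLam S) ≫ sqImFlip S = pullback.lift (pullback.snd _ _) (pullback.fst _ _)
      pullback.condition.symm ≫ coker (sqLam S.flip) := coker_cokerDesc _ _ _

lemma sqKerFlip_ker (S : CommSq f a b g) : sqKerFlip S ≫ ker (sqRho S.flip) =
    ker (sqRho S) ≫ pushout.desc (pushout.inr _ _) (pushout.inl _ _) pushout.condition.symm :=
  kerLift_ker _ _ _

lemma sqImFlip_sqImFlip (S : CommSq f a b g) : sqImFlip S ≫ sqImFlip S.flip = 𝟙 (SqIm S) := by
  rw [← cancel_epi (coker (sqLam S)), ← Category.assoc, coker_sqImFlip, Category.assoc,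
    coker_sqImFlip, ← Category.assoc]
  refine Eq.trans ?_ (Category.comp_id _).symm
  refine Eq.trans ?_ (Category.id_comp _)
  congr 1
  apply pullback.hom_ext
  · rw [Category.assoc, Category.id_comp]
    exact (congrArg _ (pullback.lift_fst _ _ _)).trans (pullback.lift_snd _ _ _)
  · rw [Category.assoc, Category.id_comp]
    exact (congrArg _ (pullback.lift_snd _ _ _)).trans (pullback.lift_fst _ _ _)

lemma sqKerFlip_sqKerFlip (S : CommSq f a b g) :
    sqKerFlip S ≫ sqKerFlip S.flip = 𝟙 (SqKer S) := by
  rw [← cancel_mono (ker (sqRho S)), Category.assoc]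
  refine (congrArg _ (sqKerFlip_ker S.flip)).trans ?_
  rw [← Category.assoc, sqKerFlip_ker, Category.assoc]
  refine Eq.trans ?_ (Category.id_comp _).symm
  refine Eq.trans ?_ (Category.comp_id _)
  congr 1
  apply pushout.hom_ext
  · rw [← Category.assoc, Category.comp_id]
    exact (congrArg (· ≫ _) (pushout.inl_desc _ _ _)).trans (pushout.inr_desc _ _ _)
  · rw [← Category.assoc, Category.comp_id]
    exact (congrArg (· ≫ _) (pushout.inr_desc _ _ _)).trans (pushout.inl_desc _ _ _)

instance (S : CommSq f a b g) : IsIso (sqImFlip S) :=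
  ⟨sqImFlip S.flip, sqImFlip_sqImFlip S, sqImFlip_sqImFlip S.flip⟩

instance (S : CommSq f a b g) : IsIso (sqKerFlip S) :=
  ⟨sqKerFlip S.flip, sqKerFlip_sqKerFlip S, sqKerFlip_sqKerFlip S.flip⟩

/-- the second coprojection of the pushout of two coimages -/
lemma isCokernel_pushout_inr (b : X ⟶ Y) (g : X ⟶ Z) :
    IsCokernel (ker b ≫ coim g) (pushout.inr (coim b) (coim g)) := by
  refine .of_epi ?_ fun y hy => ?_
  · rw [Category.assoc, ← pushout.condition, ← Category.assoc]
    exact null_right (coker_null _) _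
  · rw [Category.assoc] at hy
    exact ⟨pushout.desc (cokerDesc _ _ hy) y (by simp), pushout.inr_desc _ _ _⟩

/-- the second projection of the pullback of two images -/
lemma isKernel_pullback_snd (b : X ⟶ Z) (g : Y ⟶ Z) :
    IsKernel (im g ≫ coker b) (pullback.snd (im b) (im g)) := by
  refine .of_mono ?_ fun y hy => ?_
  · rw [← Category.assoc, ← pullback.condition, Category.assoc]
    exact null_left _ (ker_null _)
  · rw [← Category.assoc] at hy
    exact ⟨pullback.lift (kerLift _ _ hy) y (by simp), pullback.lift_snd _ _ _⟩

end Square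
namespace Diagram

variable [HomologicalCategory 𝒞] (D : Diagram 𝒞)

/-! ### The ends of the sequence: kernel of `ϰ` and cokernel of `ϰ'` -/

lemma coker_q : coker (kerLift D.gHat D.fHat D.fHat_gHat) ≫ D.q = coker D.μ :=
  coker_cokerDesc _ _ _

lemma q'_ker : D.q' ≫ ker (cokerDesc D.fCheck D.gCheck D.fCheck_gCheck) = ker D.μ' :=
  kerLift_ker _ _ _

lemma μ_ker : D.μ ≫ ker D.gHat = ker D.ξ := kerLift_ker _ _ _

lemma coker_μ' : coker D.fCheck ≫ D.μ' = coker D.ξ' := coker_cokerDesc _ _ _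

lemma vv_ker : D.vv ≫ ker D.η = ker D.gHat ≫ D.ξ := kerLift_ker _ _ _

lemma coker_vv' : coker D.η' ≫ D.vv' = D.ξ' ≫ coker D.fCheck := coker_cokerDesc _ _ _

lemma coker_vBar : coker D.μ ≫ D.vBar = D.vv := coker_cokerDesc _ _ _

lemma vBar'_ker : D.vBar' ≫ ker D.μ' = D.vv' := kerLift_ker _ _ _

/-- Followed by the kernel `ker η`, `vv` becomes `ker gHat ≫ ξ`, and what this kills is the part of
`Ker gHat` inside `Ker ξ`, which is all of `Ker ξ`. -/
lemma isKernel_μ : IsKernel D.vv D.μ := by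
  refine .of_comp (e := ker D.η) ?_ fun _ hx => (ker_isKernel _).null_of hx
  have : Mono (D.μ ≫ ker D.gHat) := by rw [μ_ker]; infer_instance
  have := mono_of_mono D.μ (ker D.gHat)
  rw [vv_ker]
  refine .of_mono ?_ fun x hx => ?_
  · rw [← Category.assoc, μ_ker]; exact ker_null _
  · obtain ⟨y, hy, -⟩ := (ker_isKernel D.ξ).lift (x ≫ ker D.gHat) (by rwa [Category.assoc])
    exact ⟨y, by rw [← cancel_mono (ker D.gHat), Category.assoc, μ_ker, hy]⟩

lemma isCokernel_μ' : IsCokernel D.vv' D.μ' := by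
  refine .of_comp (e := coker D.η') ?_ fun _ hx => (coker_isCokernel _).null_of hx
  have : Epi (coker D.fCheck ≫ D.μ') := by rw [coker_μ']; infer_instance
  have := epi_of_epi (coker D.fCheck) D.μ'
  rw [coker_vv']
  refine .of_epi ?_ fun x hx => ?_
  · rw [Category.assoc, coker_μ']; exact coker_null _
  · obtain ⟨y, hy, -⟩ := (coker_isCokernel D.ξ').desc (coker D.fCheck ≫ x) (by
      rwa [← Category.assoc])
    exact ⟨y, by rw [← cancel_epi (coker D.fCheck), ← Category.assoc, coker_μ', hy]⟩

/-- Third isomorphism theorem for `Ker a ⟶ Ker ξ ⟶ Ker gHat`: the quotient of `Ker ξ` by the image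
of `Ker a` sits in `HKer` as the kernel of the projection to `Coker μ`. -/
lemma isKernel_p : IsKernel D.q D.p := by
  refine IsKernel.quotient (y := D.lam) (c := coker D.lam) (ι := D.μ)
    (k := coker (kerLift D.gHat D.fHat D.fHat_gHat)) ?_ (coker_isCokernel _) ?_
    (coker_cokerDesc _ _ _)
  · rw [coker_q]
    exact D.isKernel_μ.of_cokernel (coker_isCokernel _)
  · rw [lam_μ]; exact coker_isCokernel _

lemma isCokernel_p' : IsCokernel D.q' D.p' := by
  refine IsCokernel.restrict (s := D.lam') (m := ker D.lam') (π := D.μ')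
    (k := ker (cokerDesc D.fCheck D.gCheck D.fCheck_gCheck)) ?_ ?_ (ker_isKernel _)
    (kerLift_ker _ _ _)
  · rw [q'_ker]
    exact D.isCokernel_μ'.of_kernel (ker_isKernel _)
  · rw [μ'_lam']; exact ker_isKernel _

theorem isKernel_p₁ (hf : IsExact D.f) : IsKernel D.ϰ (D.p₁ hf) := by
  have h1 : IsKernel D.ϰ D.p := by
    -- Beyond `q`, `ϰ` is `vBar` followed by an isomorphism, and `vBar` reflects null morphisms
    -- because `Coker μ` is a coimage of `vv`.
    refine D.isKernel_p.comp_of_null _ fun x hx => ?_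
    rw [← Category.assoc] at hx
    exact null_of_fromCoim D.isKernel_μ (coker_isCokernel _) D.coker_vBar
      (null_of_null_comp_iso _ hx)
  have := h1.iso_comp (sqKerFlip D.S ≫ inv (D.lambekS₀S hf) ≫ inv D.cokerLamIm)
  simpa only [p₁, Category.assoc] using this

theorem isCokernel_p₁' (hg' : IsExact D.g') : IsCokernel D.ϰ' (D.p₁' hg') := by
  have h1 : IsCokernel (inv D.cokerη'H ≫ D.vBar' ≫ D.q') D.p' := by
    rw [← Category.assoc]
    refine D.isCokernel_p'.comp_of_null _ fun x hx => ?_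
    rw [Category.assoc] at hx
    exact null_of_toIm D.isCokernel_μ' (ker_isKernel _) D.vBar'_ker
      (null_of_null_iso_comp _ hx)
  have h2 := h1.iso_comp (homologyComparison D.fCheck D.gCheck D.fCheck_gCheck) (g := D.ϰ') (by
    simp [ϰ'])
  have := h2.comp_iso (inv D.kerLam' ≫ inv (D.lambekTT₀ hg') ≫ sqImFlip D.T.flip)
  simpa only [p₁', Category.assoc] using this

/-- Properties of `ϰ` are tested on `vv`: the two differ only by a cokernel in front and an
isomorphism behind. -/
lemma coker_ϰ_kerHη : coker (kerLift D.gHat D.fHat D.fHat_gHat) ≫ D.ϰ ≫ D.kerHη = D.vv := by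
  rw [ϰ, Category.assoc, Category.assoc, IsIso.inv_hom_id, Category.comp_id, ← Category.assoc,
    coker_q, coker_vBar]

lemma cokerη'H_ϰ'_ker : D.cokerη'H ≫ D.ϰ' ≫
    homologyComparison D.fCheck D.gCheck D.fCheck_gCheck ≫
      ker (cokerDesc D.fCheck D.gCheck D.fCheck_gCheck) = D.vv' := by
  simp only [ϰ', Category.assoc, IsIso.inv_hom_id_assoc, IsIso.hom_inv_id_assoc, q'_ker,
    vBar'_ker]

/-! ### The identifications of `Im S` with `Coker ξ` and of `Ker T` with `Ker ξ'` -/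

/-- the isomorphism `Coker ξ ⟶ Im S` given by Lambek's isomorphisms -/
noncomputable def cokerξSqIm (hb : IsExact D.b) : Coker D.ξ ⟶ SqIm D.S :=
  D.cokerξIm ≫ D.lambekS₂S₁ ≫ sqKerFlip D.S₁.flip ≫ inv (D.lambekSS₁ hb)

instance : IsIso D.cokerξIm := by
  have := isIso_im (null_coker_coker D.f)
  let e : Ker D.bCheck ⟶ pullback (im (coker D.f)) (im (ker D.bCheck)) := pullback.lift
    (kerLift (coker (coker D.f)) (ker D.bCheck) (null_left _ (null_coker_coker D.f)))
    (toIm (ker D.bCheck)) (by simp)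
  -- The cokernel of `coker f` is null, so `im (coker f)` is invertible and the pullback reduces to
  -- `Im (ker bCheck)`, that is, to `Ker bCheck`.
  have he : IsIso e := by
    have : IsIso (e ≫ pullback.snd _ _) := by
      rw [pullback.lift_snd]; infer_instance
    exact IsIso.of_isIso_comp_right e (pullback.snd _ _)
  have hξ : D.ξ ≫ e = sqLam D.S₂.flip := by
    apply pullback.hom_ext
    · rw [sqLam_fst, Category.assoc, pullback.lift_fst, ← cancel_mono (im (coker D.f))]
      simp
    · rw [sqLam_snd, Category.assoc, pullback.lift_snd]
  refine (coker_isCokernel D.ξ).isIso (l' := e ≫ coker (sqLam D.S₂.flip)) ?_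
    (coker_cokerDesc _ _ _)
  exact (coker_isCokernel (sqLam D.S₂.flip)).iso_comp e hξ

instance : IsIso D.lambekS₂S₁ :=
  isIso_lambek _ _ _ _ _ (exactAt_ker _) (exactAt_ker _)

instance (hb : IsExact D.b) : IsIso (D.cokerξSqIm hb) := by
  unfold cokerξSqIm; infer_instance

lemma β_eq (hb : IsExact D.b) :
    D.β hb = D.kerHη ≫ (ker D.η ≫ coker D.ξ) ≫ D.cokerξSqIm hb := rfl

/-- the isomorphism `Ker T ⟶ Ker ξ'` given by Lambek's isomorphisms -/
noncomputable def sqKerKerξ' (hb : IsExact D.b) : SqKer D.T ⟶ Ker D.ξ' :=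
  inv (D.lambekT₁T hb) ≫ sqImFlip D.T₁ ≫ D.lambekT₁T₂ ≫ D.kerξ'

instance : IsIso D.kerξ' := by
  have := isIso_coim (null_ker_ker D.g')
  let e : pushout (coim (ker D.g')) (coim (coker D.bHat)) ⟶ Coker D.bHat := pushout.desc
    (cokerDesc (ker (ker D.g')) (coker D.bHat) (null_right (null_ker_ker D.g') _))
    (fromCoim (coker D.bHat)) (by simp)
  -- The kernel of `ker g'` is null, so `coim (ker g')` is invertible and the pushout reduces to
  -- `Coim (coker bHat)`, that is, to `Coker bHat`.
  have he : IsIso e := by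
    have : IsIso (pushout.inr _ _ ≫ e) := by
      rw [pushout.inr_desc]; infer_instance
    exact IsIso.of_isIso_comp_left (pushout.inr _ _) e
  have hξ : e ≫ D.ξ' = sqRho D.T₂.flip := by
    apply pushout.hom_ext
    · rw [inl_sqRho, ← Category.assoc, pushout.inl_desc, ← cancel_epi (coim (ker D.g'))]
      simp
    · rw [inr_sqRho, ← Category.assoc, pushout.inr_desc]
  refine IsKernel.isIso (k := ker (sqRho D.T₂.flip) ≫ e) ?_ (ker_isKernel D.ξ')
    (kerLift_ker _ _ _)
  exact (ker_isKernel (sqRho D.T₂.flip)).comp_iso e hξ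

instance : IsIso D.lambekT₁T₂ :=
  isIso_lambek _ _ _ _ _ (exactAt_coker _) (exactAt_coker _)

instance (hb : IsExact D.b) : IsIso (D.sqKerKerξ' hb) := by
  unfold sqKerKerξ'; infer_instance

lemma β'_eq (hb : IsExact D.b) :
    D.β' hb = D.sqKerKerξ' hb ≫ (ker D.ξ' ≫ coker D.η') ≫ D.cokerη'H := by
  simp only [β', sqKerKerξ', Category.assoc]

/-! ### Lambek's morphism in terms of `kerToCoim` and `imToCoker` -/

/-- the morphism from `Ker (Coker f ⟶ Coker f')` to the coimage of `g` -/
noncomputable def kerToCoim : Ker D.bCheck ⟶ Coim D.g :=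
  ker D.bCheck ≫ cokerDesc D.f (coim D.g) (null_coim D.null)

/-- the morphism from the image of `f'` to `Coker (Ker g ⟶ Ker g')` -/
noncomputable def imToCoker : Im D.f' ⟶ Coker D.bHat :=
  kerLift D.g' (im D.f') (im_null D.null') ≫ coker D.bHat

lemma ξ_kerToCoim : D.ξ ≫ D.kerToCoim = ker D.b ≫ coim D.g := by
  simp [kerToCoim]

lemma imToCoker_ξ' : D.imToCoker ≫ D.ξ' = im D.f' ≫ coker D.b := by
  simp [imToCoker]

lemma kerToCoim_fromCoim : D.kerToCoim ≫ fromCoim D.g = D.η ≫ ker D.c := by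
  have : cokerDesc D.f (coim D.g) (null_coim D.null) ≫ fromCoim D.g = D.τ := by
    rw [← cancel_epi (coker D.f)]; simp
  rw [kerToCoim, Category.assoc, this, kerMap_ker]

lemma toIm_imToCoker : toIm D.f' ≫ D.imToCoker = coker D.a ≫ D.η' := by
  have : toIm D.f' ≫ kerLift D.g' (im D.f') (im_null D.null') = D.σ' := by
    rw [← cancel_mono (ker D.g')]; simp
  rw [imToCoker, ← Category.assoc, this, coker_cokerMap]

/-- the morphism from the pushout that defines `Ker S₁` to the pushout that defines `Ker T` -/
noncomputable def pushoutMap :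
    pushout (coim D.b) (coim (coker D.f)) ⟶ pushout (coim D.b) (coim D.g) :=
  pushout.desc (pushout.inl _ _)
    (fromCoim (coker D.f) ≫ cokerDesc D.f (coim D.g) (null_coim D.null) ≫ pushout.inr _ _)
    (by simp [pushout.condition])

/-- the morphism from the pullback that defines `Im S` to the pullback that defines `Im T₁` -/
noncomputable def pullbackMap :
    pullback (im D.b) (im D.f') ⟶ pullback (im D.b) (im (ker D.g')) :=
  pullback.lift (pullback.fst _ _)
    (pullback.snd _ _ ≫ kerLift D.g' (im D.f') (im_null D.null') ≫ toIm (ker D.g'))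
    (by simp [pullback.condition])

/-- Both Lambek morphisms start from `S` and pass through the same identification of `Im b` with
`Coim b`. They differ only in the final pushout, and `pushoutMap` respects the coprojection from
`Coim b`. -/
lemma Λ_ker (hb : IsExact D.b) : D.Λ hb ≫ ker (sqRho D.T) =
    D.lambekSS₁ hb ≫ ker (sqRho D.S₁) ≫ D.pushoutMap := by
  have := coker_lambek_ker D.S D.S₁ hb (coker_null D.f) (coker_null D.f')
  rw [← cancel_epi (coker (sqLam D.S)), Λ, lambekSS₁, coker_lambek_ker]
  simp only [← Category.assoc] at this ⊢
  rw [this, lambekAux, lambekAux, Category.assoc, Category.assoc, pushoutMap, pushout.inl_desc]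

lemma coker_Λ (hb : IsExact D.b) : coker (sqLam D.S) ≫ D.Λ hb =
    D.pullbackMap ≫ coker (sqLam D.T₁) ≫ D.lambekT₁T hb := by
  have := coker_lambek_ker D.T₁ D.T hb (ker_null D.g) (ker_null D.g')
  rw [← cancel_mono (ker (sqRho D.T)), Category.assoc, Category.assoc, Category.assoc, lambekT₁T,
    this, Λ, coker_lambek_ker, lambekAux, lambekAux, ← Category.assoc D.pullbackMap, pullbackMap,
    pullback.lift_fst]

lemma coker_cokerξSqIm_lambekSS₁_ker (hb : IsExact D.b) :
    coker D.ξ ≫ D.cokerξSqIm hb ≫ D.lambekSS₁ hb ≫ ker (sqRho D.S₁) =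
      ker D.bCheck ≫ inv (fromCoim (coker D.f)) ≫ pushout.inr (coim D.b) (coim (coker D.f)) := by
  have h1 := sqKerFlip_ker D.S₁.flip
  have h2 := coker_lambek_ker D.S₂.flip D.S₁.flip (isExact_coker D.f) (ker_null D.b)
    (ker_null D.bCheck)
  simp only [cokerξSqIm, Category.assoc, IsIso.inv_hom_id_assoc]
  -- Transposing twice gives back `S₁` definitionally; `h3` restates `h1` in the form in which it
  -- can be used for rewriting.
  have h3 : sqKerFlip D.S₁.flip ≫ ker (sqRho D.S₁) = _ := h1
  -- For the cokernel `coker f`, passing from image to coimage amounts to inverting `fromCoim (coker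
  -- f)`.
  have h4 : kerLift (coker (coker D.f)) (ker D.bCheck) (null_left _ (null_coker_coker D.f)) ≫
      midInv (coker D.f) (isExact_coker D.f) = ker D.bCheck ≫ inv (fromCoim (coker D.f)) := by
    rw [IsIso.eq_comp_inv]; simp
  rw [h3, cokerξIm, coker_cokerDesc_assoc, Category.assoc, lambekS₂S₁]
  simp only [← Category.assoc] at h2 h4 ⊢
  rw [← h4]
  simp only [Category.assoc] at h2 ⊢
  rw [reassoc_of% h2, lambekAux, Category.assoc, Category.assoc, pushout.inl_desc,
    ← Category.assoc, pullback.lift_fst]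

lemma coker_lambekT₁T_sqKerKerξ'_ker (hb : IsExact D.b) :
    coker (sqLam D.T₁) ≫ D.lambekT₁T hb ≫ D.sqKerKerξ' hb ≫ ker D.ξ' =
      pullback.snd (im D.b) (im (ker D.g')) ≫ inv (toIm (ker D.g')) ≫ coker D.bHat := by
  have h1 := coker_sqImFlip D.T₁
  have h2 := coker_lambek_ker D.T₁.flip D.T₂.flip (isExact_ker D.g') (coker_null D.bHat)
    (coker_null D.b)
  have h3 : midInv (ker D.g') (isExact_ker D.g') ≫ cokerDesc (ker (ker D.g')) (coker D.bHat)
      (null_right (null_ker_ker D.g') _) = inv (toIm (ker D.g')) ≫ coker D.bHat := by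
    rw [IsIso.eq_inv_comp]; simp
  simp only [sqKerKerξ', Category.assoc, IsIso.hom_inv_id_assoc]
  rw [reassoc_of% h1, kerξ', kerLift_ker, lambekT₁T₂, reassoc_of% h2, lambekAux, ← h3]
  simp only [Category.assoc]
  rw [pushout.inl_desc, ← Category.assoc, pullback.lift_fst]

/-- This exhibits `Λ`, preceded by the identification with `Coker ξ` and followed by the embedding
of `Ker T`, as the morphism that `kerToCoim` induces from `Coker ξ` to the cokernel of `ξ ≫
kerToCoim`. -/
lemma coker_cokerξSqIm_Λ_ker (hb : IsExact D.b) :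
    coker D.ξ ≫ D.cokerξSqIm hb ≫ D.Λ hb ≫ ker (sqRho D.T) =
      D.kerToCoim ≫ pushout.inr (coim D.b) (coim D.g) := by
  have := coker_cokerξSqIm_lambekSS₁_ker D hb
  rw [Λ_ker]
  simp only [← Category.assoc] at this ⊢
  rw [this, Category.assoc _ _ D.pushoutMap, pushoutMap, pushout.inr_desc, Category.assoc,
    IsIso.inv_hom_id_assoc, kerToCoim, Category.assoc]

/-- Dually, `Λ` is the morphism that `imToCoker` induces from the kernel of `imToCoker ≫ ξ'`, a
projection of the pullback, to `Ker ξ'`. -/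
lemma coker_Λ_sqKerKerξ'_ker (hb : IsExact D.b) :
    coker (sqLam D.S) ≫ D.Λ hb ≫ D.sqKerKerξ' hb ≫ ker D.ξ' =
      pullback.snd (im D.b) (im D.f') ≫ D.imToCoker := by
  rw [← Category.assoc, coker_Λ]
  simp only [Category.assoc]
  rw [coker_lambekT₁T_sqKerKerξ'_ker, ← Category.assoc, pullbackMap, pullback.lift_snd]
  simp [imToCoker]

/-- `kerToCoim ≫ fromCoim g` equals `η ≫ ker c`, and both second factors reflect null morphisms, so
`kerToCoim` and `η` have the same kernel. -/
lemma isKernel_kerToCoim_fromCoim : IsKernel D.kerToCoim (ker D.η) := by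
  have h := (ker_isKernel D.η).comp_of_null (ker D.c) fun _ hx => (ker_isKernel _).null_of hx
  rw [← kerToCoim_fromCoim] at h
  exact h.of_comp fun x hx =>
    null_of_fromCoim (ker_isKernel D.g) (coker_isCokernel _) (coim_fromCoim D.g) hx

lemma isCokernel_imToCoker : IsCokernel D.imToCoker (coker D.η') := by
  have h := (coker_isCokernel D.η').comp_of_null (coker D.a)
    fun _ hx => (coker_isCokernel _).null_of hx
  rw [← toIm_imToCoker] at h
  exact h.of_comp fun x hx =>
    null_of_toIm (coker_isCokernel D.f') (ker_isKernel _) (toIm_im D.f') hx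

/-! ### Nullity and exactness of the sequence -/

theorem null_ϰ_β (hb : IsExact D.b) : Null (D.ϰ ≫ D.β hb) := by
  apply (coker_isCokernel (kerLift D.gHat D.fHat D.fHat_gHat)).null_of
  have h := coker_ϰ_kerHη D
  rw [β_eq]
  simp only [← Category.assoc] at h ⊢
  rw [h, vv_ker]
  exact null_right (by rw [Category.assoc]; exact null_left _ (coker_null _)) _

theorem null_β'_ϰ' (hb : IsExact D.b) : Null (D.β' hb ≫ D.ϰ') := by
  apply null_of_null_comp_iso (homologyComparison D.fCheck D.gCheck D.fCheck_gCheck)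
  apply (ker_isKernel (cokerDesc D.fCheck D.gCheck D.fCheck_gCheck)).null_of
  rw [β'_eq]
  simp only [Category.assoc, cokerη'H_ϰ'_ker, coker_vv']
  exact null_left _ (by rw [← Category.assoc]; exact null_right (ker_null _) _)

theorem null_β_Λ (hb : IsExact D.b) : Null (D.β hb ≫ D.Λ hb) := by
  apply (ker_isKernel (sqRho D.T)).null_of
  rw [β_eq]
  simp only [Category.assoc, coker_cokerξSqIm_Λ_ker]
  refine null_left _ ?_
  rw [← Category.assoc]
  exact null_right D.isKernel_kerToCoim_fromCoim.null _

theorem null_Λ_β' (hb : IsExact D.b) : Null (D.Λ hb ≫ D.β' hb) := by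
  apply (coker_isCokernel (sqLam D.S)).null_of
  have h := D.coker_Λ_sqKerKerξ'_ker hb
  rw [β'_eq]
  simp only [← Category.assoc] at h ⊢
  rw [h, Category.assoc _ D.imToCoker]
  exact null_right (null_left _ D.isCokernel_imToCoker.null) _

theorem exactAt_ϰ (hb : IsExact D.b) (h : IsExact (ker D.b ≫ coker D.f)) :
    ExactAt D.ϰ (D.β hb) ∧ IsExact D.ϰ := by
  rw [← kerMap_ker D.S₁] at h
  -- After the rewriting, `h` concerns `ξ ≫ ker bCheck`, from which the kernel can be cancelled.
  have hξ : IsExact D.ξ := h.of_comp_kernel (ker_isKernel _).some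
  obtain ⟨h1, h2⟩ := exact_ker_comp hξ (coker_isCokernel _) (ker_isKernel D.η)
    (by rw [ξ_η]; exact ker_isKernel D.gHat) D.vv_ker
  rw [← coker_ϰ_kerHη] at h1 h2
  have hc := (coker_isCokernel (kerLift D.gHat D.fHat D.fHat_gHat)).some
  have h3 := h1.of_cokernel_comp hc
  refine ⟨?_, h3.of_comp_kernel (isSomeKernel_of_isIso _)⟩
  have h4 := (h2.of_cokernel_comp hc).comp_iso (inv D.kerHη)
    (g' := D.kerHη ≫ ker D.η ≫ coker D.ξ) (by simp)
  rw [Category.assoc, IsIso.hom_inv_id, Category.comp_id] at h4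
  simpa only [β_eq, Category.assoc] using h4.postcomp_iso (D.cokerξSqIm hb)

theorem exactAt_Λ (hb : IsExact D.b) (hg : IsExact D.g) (hη : IsExact D.η) :
    ExactAt (D.β hb) (D.Λ hb) ∧ IsExact (D.Λ hb) := by
  -- Exactness of `g` makes `fromCoim g` a kernel; it can then be cancelled from `kerToCoim ≫
  -- fromCoim g = η ≫ ker c`, which is exact because `η` is.
  have hk : IsExact D.kerToCoim := by
    refine IsExact.of_comp_kernel (k := fromCoim D.g) ?_ hg.isSomeKernel_fromCoim
    rw [kerToCoim_fromCoim]
    exact hη.comp_kernel (ker_isKernel _).some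
  -- The composite is `ξ ≫ kerToCoim`, whose cokernel is the coprojection `pushout.inr`. The kernel
  -- `ker (sqRho T)` at the end of the induced morphism is removed afterwards.
  obtain ⟨h1, h2⟩ := exact_comp_coker hk D.isKernel_kerToCoim_fromCoim (coker_isCokernel D.ξ)
    (by rw [ξ_kerToCoim]; exact isCokernel_pushout_inr D.b D.g) (D.coker_cokerξSqIm_Λ_ker hb)
  have hρ := ker_isKernel (sqRho D.T)
  rw [← Category.assoc] at h1 h2
  have h3 : ExactAt (ker D.η ≫ coker D.ξ) (D.cokerξSqIm hb ≫ D.Λ hb) :=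
    IsKernel.of_comp h2 fun _ => hρ.null_of
  refine ⟨?_, (h1.of_comp_kernel hρ.some).of_cokernel_comp (isSomeCokernel_of_isIso _)⟩
  have h4 := h3.comp_iso (D.cokerξSqIm hb) rfl
  rw [β_eq]
  refine ExactAt.of_cokernel_comp (l := inv D.kerHη) ?_ (isSomeCokernel_of_isIso _)
  simpa using h4

theorem exactAt_Λ' (hb : IsExact D.b) (hf' : IsExact D.f') (hη' : IsExact D.η') :
    ExactAt (D.Λ hb) (D.β' hb) ∧ IsExact (D.Λ hb) := by
  have hk : IsExact D.imToCoker := by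
    refine IsExact.of_cokernel_comp (l := toIm D.f') ?_ hf'.isSomeCokernel_toIm
    rw [toIm_imToCoker]
    exact hη'.cokernel_comp (coker_isCokernel _).some
  -- The composite is `imToCoker ≫ ξ'`, whose kernel is the projection `pullback.snd`. The cokernel
  -- `coker (sqLam S)` at the start of the induced morphism is removed afterwards.
  obtain ⟨h1, h2⟩ := exact_ker_comp hk D.isCokernel_imToCoker (ker_isKernel D.ξ')
    (by rw [imToCoker_ξ']; exact isKernel_pullback_snd D.b D.f')
    (v := coker (sqLam D.S) ≫ D.Λ hb ≫ D.sqKerKerξ' hb)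
    (by simpa using D.coker_Λ_sqKerKerξ'_ker hb)
  have hc := (coker_isCokernel (sqLam D.S)).some
  have h3 := h1.of_cokernel_comp hc
  refine ⟨?_, h3.of_comp_kernel (isSomeKernel_of_isIso _)⟩
  have h4 := (h2.of_cokernel_comp hc).comp_iso (inv (D.sqKerKerξ' hb))
    (g' := D.sqKerKerξ' hb ≫ ker D.ξ' ≫ coker D.η') (by simp)
  rw [Category.assoc, IsIso.hom_inv_id, Category.comp_id] at h4
  simpa only [β'_eq, Category.assoc] using h4.postcomp_iso D.cokerη'H

theorem exactAt_ϰ' (hb : IsExact D.b) (h : IsExact (ker D.g' ≫ coker D.b)) :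
    ExactAt (D.β' hb) D.ϰ' ∧ IsExact D.ϰ' := by
  rw [← coker_cokerMap D.T₁] at h
  have hξ : IsExact D.ξ' := h.of_cokernel_comp (coker_isCokernel _).some
  obtain ⟨h1, h2⟩ := exact_comp_coker hξ (ker_isKernel _) (coker_isCokernel D.η')
    (by rw [η'_ξ']; exact coker_isCokernel D.fCheck) D.coker_vv'
  rw [← cokerη'H_ϰ'_ker] at h1 h2
  have hk := ker_isKernel (cokerDesc D.fCheck D.gCheck D.fCheck_gCheck)
  simp only [← Category.assoc] at h1 h2
  have h3 := (h1.of_comp_kernel hk.some).of_comp_kernel (isSomeKernel_of_isIso _)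
  refine ⟨?_, h3.of_cokernel_comp (isSomeCokernel_of_isIso _)⟩
  -- The kernel and the homology comparison that follow `ϰ'` both reflect null morphisms, so
  -- dropping them does not change the kernel on the right.
  have h4 : ExactAt (ker D.ξ' ≫ coker D.η') (D.cokerη'H ≫ D.ϰ') :=
    IsKernel.of_comp (IsKernel.of_comp h2 fun _ => hk.null_of) fun _ =>
      null_of_null_comp_iso (homologyComparison D.fCheck D.gCheck D.fCheck_gCheck)
  have h5 := h4.comp_iso D.cokerη'H rfl
  rw [β'_eq]
  refine ExactAt.of_cokernel_comp (l := inv (D.sqKerKerξ' hb)) ?_ (isSomeCokernel_of_isIso _)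
  simpa using h5

end Diagram
end Nomura

theorem mainTheorem4 {𝒞 : Type*} [Category 𝒞] [Nomura.HomologicalCategory 𝒞]
    (D : Nomura.Diagram 𝒞)
    (hb : Nomura.IsExact D.b) (hf : Nomura.IsExact D.f) (hg' : Nomura.IsExact D.g') :
    -- the sequence is a null sequence
    (Nomura.Null (D.p₁ hf ≫ D.ϰ) ∧ Nomura.Null (D.ϰ ≫ D.β hb) ∧
      Nomura.Null (D.β hb ≫ D.Λ hb) ∧ Nomura.Null (D.Λ hb ≫ D.β' hb) ∧
      Nomura.Null (D.β' hb ≫ D.ϰ') ∧ Nomura.Null (D.ϰ' ≫ D.p₁' hg')) ∧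
    -- (i)
    Nomura.IsKernel D.ϰ (D.p₁ hf) ∧
    Nomura.IsCokernel D.ϰ' (D.p₁' hg') ∧
    (Nomura.IsExact (Nomura.ker D.b ≫ Nomura.coker D.f) →
      Nomura.ExactAt D.ϰ (D.β hb) ∧ Nomura.IsExact D.ϰ) ∧
    (Nomura.IsExact (Nomura.ker D.g' ≫ Nomura.coker D.b) →
      Nomura.ExactAt (D.β' hb) D.ϰ' ∧ Nomura.IsExact D.ϰ') ∧
    -- (ii)
    (Nomura.IsExact D.g → Nomura.IsExact D.η →
      Nomura.ExactAt (D.β hb) (D.Λ hb) ∧ Nomura.IsExact (D.Λ hb)) ∧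
    (Nomura.IsExact D.f' → Nomura.IsExact D.η' →
      Nomura.ExactAt (D.Λ hb) (D.β' hb) ∧ Nomura.IsExact (D.Λ hb)) :=
  ⟨⟨(D.isKernel_p₁ hf).null, D.null_ϰ_β hb, D.null_β_Λ hb, D.null_Λ_β' hb, D.null_β'_ϰ' hb,
    (D.isCokernel_p₁' hg').null⟩, D.isKernel_p₁ hf, D.isCokernel_p₁' hg', D.exactAt_ϰ hb,
    D.exactAt_ϰ' hb, D.exactAt_Λ hb, D.exactAt_Λ' hb⟩
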